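/- Consider the linear plant \[ \dot w = Sw,\qquad \dot x = Ax+Bu+Pw,\qquad e = C_e x+Q_e w , \] with $w\in\mathbb{R}^{n_w}$, $x\in\mathbb{R}^n$, $u\in\mathbb{R}^m$, $e\in\mathbb{R}^p$, where $x$ and $e$ are measured, and assume that every solution $w:\mathbb{R}\to\mathbb{R}^{n_w}$ of $\dot w=Sw$ is bounded and periodic. A linear regulator, with inputs $(e,x)$, state $\xi$ of any finite dimension and output $u$, \[ \dot\xi = F\xi+F_e e+F_x x,\qquad u = H\xi+H_e e+H_x x, \] \emph{solves the output regulation problem} if (i) for $w=0$ the closed-loop system in $(x,\xi)$ is asymptotically stable, and (ii) $e(t)\to 0$ as $t\to+\infty$ for all initial conditions of $w$, $x$, $\xi$. The problem is \emph{solvable} if some such regulator solves it. Let $m_S(\lambda)=s_0+s_1\lambda+\dots+s_{d-1}\lambda^{d-1}+\lambda^d$ be the minimal polynomial of $S$, let $n_\eta=pd$, and consider the internal model $\dot\eta=\Phi\eta+Ge$ with \[ \Phi=\begin{bmatrix}0&I_p&0&\cdots&0\\0&0&I_p&\cdots&0\\ \vdots&\vdots&\vdots&\ddots&\vdots\\0&0&0&\cdots&I_p\\-s_0I_p&-s_1I_p&-s_2I_p&\cdots&-s_{d-1}I_p\end{bmatrix}\in\mathbb{R}^{n_\eta\times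 n_\eta},\qquad G=\begin{bmatrix}0\\0\\ \vdots\\0\\I_p\end{bmatrix}\in\mathbb{R}^{n_\eta\times p}. \] Run an experiment on plant and internal model, i.e. take a trajectory $(w,x,\eta)$ on $[0,\infty)$ generated by some input $u$, and sample it at times $0<t_0<\dots<t_{T-1}$ (at a jump of $u$, time derivatives are right derivatives). Put \[ U_0=[u(t_0)\ \cdots\ u(t_{T-1})],\quad \mathcal{Z}_0=\begin{bmatrix}x(t_0)&\cdots&x(t_{T-1})\\ \eta(t_0)&\cdots&\eta(t_{T-1})\end{bmatrix},\quad \mathcal{Z}_1=\begin{bmatrix}\dot x(t_0)&\cdots&\dot x(t_{T-1})\\ \dot\eta(t_0)&\cdots&\dot\eta(t_{T-1})\end{bmatrix}. \] For an eigenvalue $\lambda$ of $S$ let $k(\lambda)$ be the multiplicity of $\lambda$ as a root of $m_S$ (the order of the largest Jordan block of $S$ with eigenvalue $\lambda$). Let $\mathcal{M}\in\mathbb{R}^{d\times T}$ be the matrix whose rows are the samples at $t_0,\dots,t_{T-1}$ of the functions $\frac{t^j}{j!}e^{\lambda t}$, for every distinct real eigenvalue $\lambda$ and $0\le j<k(\lambda)$,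 and $\frac{t^j}{j!}e^{\mu t}\cos(\psi t)$, $\frac{t^j}{j!}e^{\mu t}\sin(\psi t)$, for every distinct pair of complex conjugate eigenvalues $\mu\pm\sqrt{-1}\,\psi$ with $\psi>0$ and $0\le j<k(\mu+\sqrt{-1}\,\psi)$. Consider the semidefinite program in the variables $\mathcal{X}=\mathcal{X}^\top\in\mathbb{R}^{(n+n_\eta)\times(n+n_\eta)}$ and $\mathcal{Y}\in\mathbb{R}^{T\times(n+n_\eta)}$: \[ \mathcal{X}\succ0,\qquad \begin{bmatrix}\mathcal{X}\\0_{d\times(n+n_\eta)}\end{bmatrix}=\begin{bmatrix}\mathcal{Z}_0\\ \mathcal{M}\end{bmatrix}\mathcal{Y},\qquad \mathcal{Z}_1\mathcal{Y}+\mathcal{Y}^\top\mathcal{Z}_1^\top\prec0. \tag{1} \] \textbf{Theorem.} If $(\mathcal{X},\mathcal{Y})$ is feasible for (1), then the regulator \[ \dot\eta=\Phi\eta+Ge,\qquad u=\mathcal{K}\begin{bmatrix}x\\ \eta\end{bmatrix},\qquad \mathcal{K}=U_0\mathcal{Y}\mathcal{X}^{-1}, \] solves the output regulation problem. Conversely,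 if the matrix $\begin{bmatrix}U_0\\ \mathcal{Z}_0\\ \mathcal{M}\end{bmatrix}$ has full row rank and the output regulation problem is solvable, then there exist $\mathcal{X}$ and $\mathcal{Y}$ satisfying (1). -/

import Mathlib

open Matrix Filter Topology
open scoped Nat

noncomputable section

namespace OutReg

/-- `z` is a trajectory on `[0, ∞)` with velocity `v`: it is continuous there and at every time
`t ≥ 0` its right derivative is `v t`. (For a continuous right-hand side these are the classical
solutions; right derivatives also admit inputs that jump, such as zero-order hold inputs.) -/
def IsTrajectory {ι : Type} [Fintype ι] (z v : ℝ → ι → ℝ) : Prop :=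
  ContinuousOn z (Set.Ici 0) ∧ ∀ t, 0 ≤ t → HasDerivWithinAt z (v t) (Set.Ici t) t

/-- Linear plant `ẇ = S w`, `ẋ = A x + B u + P w`, with regulated error `e = Cₑ x + Qₑ w`. The
state `x` and the error `e` are measured, the exosystem state `w` is not. -/
structure Plant (nw n m p : ℕ) where
  S : Matrix (Fin nw) (Fin nw) ℝ
  A : Matrix (Fin n) (Fin n) ℝ
  B : Matrix (Fin n) (Fin m) ℝ
  P : Matrix (Fin n) (Fin nw) ℝ
  Ce : Matrix (Fin p) (Fin n) ℝ
  Qe : Matrix (Fin p) (Fin nw) ℝ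

/-- Every solution `w : ℝ → ℝ^nw` of the exosystem `ẇ = S w` is bounded and periodic. -/
def ExosystemPeriodic {nw : ℕ} (S : Matrix (Fin nw) (Fin nw) ℝ) : Prop :=
  ∀ w : ℝ → Fin nw → ℝ, (∀ t, HasDerivAt w (S *ᵥ w t) t) →
    (∃ c, ∀ t, ‖w t‖ ≤ c) ∧ ∃ D, 0 < D ∧ Function.Periodic w D

/-- Regulation error. -/
def Plant.err {nw n m p : ℕ} (Pl : Plant nw n m p) (w : Fin nw → ℝ) (x : Fin n → ℝ) :
    Fin p → ℝ :=
  Pl.Ce *ᵥ x + Pl.Qe *ᵥ w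

/-! ### Regulators and the output regulation problem -/

/-- A linear regulator with state `ξ` (indexed by `κ`) fed by the measurements `(e, x)`:
`ξ̇ = F ξ + Fe e + Fx x`, `u = H ξ + He e + Hx x`. -/
structure Regulator (n m p : ℕ) (κ : Type) where
  F : Matrix κ κ ℝ
  Fe : Matrix κ (Fin p) ℝ
  Fx : Matrix κ (Fin n) ℝ
  H : Matrix (Fin m) κ ℝ
  He : Matrix (Fin m) (Fin p) ℝ
  Hx : Matrix (Fin m) (Fin n) ℝ

section ClosedLoop

variable {nw n m p : ℕ} {κ : Type} [Fintype κ]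

/-- Control value produced by the regulator. -/
def Regulator.control (R : Regulator n m p κ) (ξ : κ → ℝ) (e : Fin p → ℝ) (x : Fin n → ℝ) :
    Fin m → ℝ :=
  R.H *ᵥ ξ + R.He *ᵥ e + R.Hx *ᵥ x

/-- `(x, ξ)` is a trajectory of plant and regulator in closed loop, driven by the signal `w`. -/
structure IsClosedLoop (Pl : Plant nw n m p) (R : Regulator n m p κ)
    (w : ℝ → Fin nw → ℝ) (x : ℝ → Fin n → ℝ) (ξ : ℝ → κ → ℝ) : Prop where
  plant : IsTrajectory x fun t =>
    Pl.A *ᵥ x t + Pl.B *ᵥ R.control (ξ t) (Pl.err (w t) (x t)) (x t) + Pl.P *ᵥ w t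
  regulator : IsTrajectory ξ fun t =>
    R.F *ᵥ ξ t + R.Fe *ᵥ Pl.err (w t) (x t) + R.Fx *ᵥ x t

/-- The regulator solves the (exact) output regulation problem: for `w = 0` the origin of the
closed loop is asymptotically stable, and for all initial conditions of exosystem, plant and
regulator the error tends to zero. -/
structure SolvesOutputRegulation (Pl : Plant nw n m p) (R : Regulator n m p κ) : Prop where
  stable : ∀ ε > 0, ∃ δ > 0, ∀ x ξ, IsClosedLoop Pl R (fun _ => 0) x ξ →
    ‖(x 0, ξ 0)‖ < δ → ∀ t, 0 ≤ t → ‖(x t, ξ t)‖ < ε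
  attractive : ∀ x ξ, IsClosedLoop Pl R (fun _ => 0) x ξ →
    Tendsto (fun t => (x t, ξ t)) atTop (𝓝 0)
  regulates : ∀ w x ξ, IsTrajectory w (fun t => Pl.S *ᵥ w t) → IsClosedLoop Pl R w x ξ →
    Tendsto (fun t => Pl.err (w t) (x t)) atTop (𝓝 0)

end ClosedLoop

/-- The output regulation problem is solvable: some linear regulator, of some finite dimension
`ν`, solves it. -/
def OutputRegulationSolvable {nw n m p : ℕ} (Pl : Plant nw n m p) : Prop :=
  ∃ (ν : ℕ) (R : Regulator n m p (Fin ν)), SolvesOutputRegulation Pl R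

/-! ### The internal model built from the minimal polynomial -/

section InternalModel

variable {nw : ℕ} (S : Matrix (Fin nw) (Fin nw) ℝ) (p : ℕ)

/-- Index set of the internal model state `η = (η₁, …, η_d)`, `ηᵢ ∈ ℝᵖ`, where `d` is the degree of
the minimal polynomial of `S`. -/
abbrev ImIdx : Type := Fin (minpoly ℝ S).natDegree × Fin p

/-- Block companion matrix of the minimal polynomial of `S` with `p × p` blocks. -/
def imΦ : Matrix (ImIdx S p) (ImIdx S p) ℝ := Matrix.of fun r c =>
  if r.2 = c.2 then
    if (r.1 : ℕ) + 1 = (minpoly ℝ S).natDegree then -(minpoly ℝ S).coeff c.1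
    else if (c.1 : ℕ) = r.1 + 1 then 1 else 0
  else 0

/-- `G = col(0, …, 0, I_p)`. -/
def imG : Matrix (ImIdx S p) (Fin p) ℝ := Matrix.of fun r c =>
  if (r.1 : ℕ) + 1 = (minpoly ℝ S).natDegree ∧ r.2 = c then 1 else 0

/-- The regulator `η̇ = Φ η + G e`, `u = 𝒦 [x; η]`. -/
def imRegulator {n m : ℕ} (K : Matrix (Fin m) (Fin n ⊕ ImIdx S p) ℝ) :
    Regulator n m p (ImIdx S p) where
  F := imΦ S p
  Fe := imG S p
  Fx := 0
  H := K.toCols₂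
  He := 0
  Hx := K.toCols₁

end InternalModel

/-! ### The known exosystem modes -/

section Modes

variable {nw : ℕ} (S : Matrix (Fin nw) (Fin nw) ℝ)

/-- Multiplicity of `z` as a root of the minimal polynomial of `S`, which is the order of the
largest Jordan block of `S` with eigenvalue `z`. -/
def blockOrder (z : ℂ) : ℕ := ((minpoly ℝ S).map (algebraMap ℝ ℂ)).rootMultiplicity z

/-- Distinct real eigenvalues of `S`. -/
def realEigs : Finset ℝ := (minpoly ℝ S).roots.toFinset

/-- Distinct pairs of complex conjugate eigenvalues of `S`, represented by the member with positive
imaginary part. -/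
def complexEigs : Finset ℂ :=
  ((minpoly ℝ S).map (algebraMap ℝ ℂ)).roots.toFinset.filter fun z => 0 < z.im

/-- Index set of the modes: a real eigenvalue whose largest Jordan block has order `k` contributes
`k` rows, a pair of complex conjugate eigenvalues `2 k` rows. -/
abbrev ModeIdx : Type :=
  (Σ l : realEigs S, Fin (blockOrder S ((l : ℝ) : ℂ))) ⊕
    (Σ l : complexEigs S, Fin (blockOrder S (l : ℂ)) × Fin 2)

/-- The modes `tʲ/j! e^{λt}` and `tʲ/j! e^{μt} cos(ψt)`, `tʲ/j! e^{μt} sin(ψt)`, `0 ≤ j < k`. -/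
def mode : ModeIdx S → ℝ → ℝ
  | Sum.inl ⟨l, j⟩, t => t ^ (j : ℕ) / ((j : ℕ)! : ℝ) * Real.exp ((l : ℝ) * t)
  | Sum.inr ⟨l, j, c⟩, t =>
      t ^ (j : ℕ) / ((j : ℕ)! : ℝ) * Real.exp ((l : ℂ).re * t) *
        (if c = 0 then Real.cos ((l : ℂ).im * t) else Real.sin ((l : ℂ).im * t))

end Modes

/-! ### The experiment and the data matrices -/

/-- An experiment on the plant augmented with the internal model `η̇ = Φ η + G e`: one trajectory
driven by an arbitrary input `u`, and sampling times `0 < t₀ < … < t_{T-1}`. -/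
structure Experiment {nw n m p : ℕ} (Pl : Plant nw n m p) (T : ℕ) where
  w : ℝ → Fin nw → ℝ
  x : ℝ → Fin n → ℝ
  η : ℝ → ImIdx Pl.S p → ℝ
  u : ℝ → Fin m → ℝ
  t : Fin T → ℝ
  t_pos : ∀ i, 0 < t i
  t_strictMono : StrictMono t
  exo : IsTrajectory w fun s => Pl.S *ᵥ w s
  plant : IsTrajectory x fun s => Pl.A *ᵥ x s + Pl.B *ᵥ u s + Pl.P *ᵥ w s
  internalModel : IsTrajectory η fun s =>
    imΦ Pl.S p *ᵥ η s + imG Pl.S p *ᵥ Pl.err (w s) (x s)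

namespace Experiment

variable {nw n m p : ℕ} {Pl : Plant nw n m p} {T : ℕ} (E : Experiment Pl T)

/-- Input samples. -/
def U0 : Matrix (Fin m) (Fin T) ℝ := Matrix.of fun i τ => E.u (E.t τ) i

/-- Samples of the augmented state `[x; η]`. -/
def Z0 : Matrix (Fin n ⊕ ImIdx Pl.S p) (Fin T) ℝ :=
  Matrix.fromRows (Matrix.of fun i τ => E.x (E.t τ) i) (Matrix.of fun i τ => E.η (E.t τ) i)

/-- Samples of the (right) time derivative of the augmented state `[x; η]`. -/
def Z1 : Matrix (Fin n ⊕ ImIdx Pl.S p) (Fin T) ℝ :=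
  Matrix.fromRows
    (Matrix.of fun i τ => derivWithin E.x (Set.Ici (E.t τ)) (E.t τ) i)
    (Matrix.of fun i τ => derivWithin E.η (Set.Ici (E.t τ)) (E.t τ) i)

/-- The known matrix `ℳ` of sampled exosystem modes. -/
def Mred : Matrix (ModeIdx Pl.S) (Fin T) ℝ := Matrix.of fun i τ => mode Pl.S i (E.t τ)

/-- `(𝒳, 𝒴)` is feasible for the semidefinite program: `𝒳 ≻ 0` (with `𝒳` symmetric),
`[𝒳; 0] = [𝒵₀; ℳ] 𝒴` and `𝒵₁ 𝒴 + 𝒴ᵀ 𝒵₁ᵀ ≺ 0`. -/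
def SDPFeasible (X : Matrix (Fin n ⊕ ImIdx Pl.S p) (Fin n ⊕ ImIdx Pl.S p) ℝ)
    (Y : Matrix (Fin T) (Fin n ⊕ ImIdx Pl.S p) ℝ) : Prop :=
  X.PosDef ∧
  Matrix.fromRows X (0 : Matrix (ModeIdx Pl.S) (Fin n ⊕ ImIdx Pl.S p) ℝ) =
    Matrix.fromRows E.Z0 E.Mred * Y ∧
  (-(E.Z1 * Y + Yᵀ * E.Z1ᵀ)).PosDef

/-- The stacked data matrix `[U₀; 𝒵₀; ℳ]`. -/
def dataMatrix : Matrix (Fin m ⊕ (Fin n ⊕ ImIdx Pl.S p) ⊕ ModeIdx Pl.S) (Fin T) ℝ :=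
  Matrix.fromRows E.U0 (Matrix.fromRows E.Z0 E.Mred)

end Experiment

end OutReg

end

/-!
Put `𝒜 = [A, 0; G Cₑ, Φ]`, `ℬ = [B; 0]`, `𝒫 = [P; G Qₑ]` for the plant augmented with the internal
model. Every exosystem solution is a combination of the modes (`exists_eq_mulVec_mode`), because a
generalized eigenvector of `S` at `λ` is annihilated by the power of `S - λ` given by the
multiplicity of `λ` in the minimal polynomial. So if `ℳ 𝒴 = 0`, the unmeasured `w` drops out of the
data and `𝒵₁ 𝒴 = 𝒜 𝒵₀ 𝒴 + ℬ U₀ 𝒴` (`Experiment.Z1_mul_eq`). Feasibility of the semidefinite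
program thus gives the Lyapunov inequality `(𝒜 + ℬ 𝒦) 𝒳 + 𝒳 (𝒜 + ℬ 𝒦)ᵀ ≺ 0`.

*Feasibility suffices.* The Lyapunov function `z ⬝ 𝒳⁻¹ z` shows exponential stability. The
Sylvester equation `Π S = (𝒜 + ℬ 𝒦) Π + 𝒫` is solvable (`exists_sylvester`): for a solution of the
homogeneous equation, `Π w` is periodic and tends to zero. The block rows of `Π` that belong to the
internal model form a chain `Πᵢ₊₁ = Πᵢ S` whose last link reads `Cₑ Πₓ + Qₑ = Π₁ m_S(S) = 0`
(`eq_zero_of_internalModel_sylvester`). Hence `e = Cₑ (x - Πₓ w) → 0`.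

*Feasibility is necessary.* By duality (`exists_lmi_of_hautus`) it is enough that no left
eigenvector `v ≠ 0` of `𝒜` at an eigenvalue `λ` with `Re λ ≥ 0` is annihilated by `ℬ`; full row
rank of the data then provides `𝒴`. If `λ` is not an eigenvalue of `S`, such a `v` has no internal
model component and describes an uncontrollable unstable mode of the plant, which contradicts
solvability. If `λ` is an eigenvalue of `S`, solvability yields a solution `(Πₓ, Γ)` of the regulator
equations (`exists_regulator_equations`), and with `Ψ = [Πₓ; 0]` the signal `v ⬝ (z - Ψ w)` solves
`ζ̇ = λ ζ`. Then `v ⬝ z` is a combination of the modes along the whole experiment, against the full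
row rank of the data (`hautus_aug`). No condition on the transmission zeros of the plant enters.
-/

/-! ### Linear differential equations with right derivatives -/

namespace OutReg

section Trajectories

variable {ι κ : Type} [Fintype ι] [Fintype κ]

lemma IsTrajectory.congr_velocity {z v v' : ℝ → ι → ℝ} (h : IsTrajectory z v)
    (hv : ∀ t, 0 ≤ t → v t = v' t) : IsTrajectory z v' :=
  ⟨h.1, fun t ht => hv t ht ▸ h.2 t ht⟩

lemma IsTrajectory.of_hasDerivAt {z v : ℝ → ι → ℝ} (h : ∀ t, HasDerivAt z (v t) t) :
    IsTrajectory z v :=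
  ⟨fun t _ => (h t).continuousAt.continuousWithinAt, fun t _ => (h t).hasDerivWithinAt⟩

lemma IsTrajectory.sub {z v z' v' : ℝ → ι → ℝ} (h : IsTrajectory z v) (h' : IsTrajectory z' v') :
    IsTrajectory (fun t => z t - z' t) (fun t => v t - v' t) :=
  ⟨h.1.sub h'.1, fun t ht => (h.2 t ht).sub (h'.2 t ht)⟩

lemma IsTrajectory.mulVec {z v : ℝ → ι → ℝ} (h : IsTrajectory z v) (M : Matrix κ ι ℝ) :
    IsTrajectory (fun t => M *ᵥ z t) (fun t => M *ᵥ v t) :=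
  have hL : ∀ x, HasFDerivAt (fun y => M *ᵥ y) (LinearMap.toContinuousLinearMap M.mulVecLin) x :=
    fun _ => (LinearMap.toContinuousLinearMap M.mulVecLin).hasFDerivAt
  ⟨(LinearMap.toContinuousLinearMap M.mulVecLin).continuous.comp_continuousOn h.1,
    fun t ht => (hL (z t)).comp_hasDerivWithinAt t (h.2 t ht)⟩

lemma hasDerivAt_mulVec {z : ℝ → ι → ℝ} {v : ι → ℝ} {t : ℝ} (h : HasDerivAt z v t)
    (M : Matrix κ ι ℝ) : HasDerivAt (fun t => M *ᵥ z t) (M *ᵥ v) t :=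
  (LinearMap.toContinuousLinearMap M.mulVecLin).hasFDerivAt.comp_hasDerivAt t h

lemma IsTrajectory.sumElim {z v : ℝ → ι → ℝ} {z' v' : ℝ → κ → ℝ} (h : IsTrajectory z v)
    (h' : IsTrajectory z' v') :
    IsTrajectory (fun t => Sum.elim (z t) (z' t)) (fun t => Sum.elim (v t) (v' t)) := by
  refine ⟨?_, fun t ht => ?_⟩
  · rw [continuousOn_pi]
    rintro (i | i)
    · exact (continuousOn_pi.1 h.1) i
    · exact (continuousOn_pi.1 h'.1) i
  · rw [hasDerivWithinAt_pi]
    rintro (i | i)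
    · exact (hasDerivWithinAt_pi.1 (h.2 t ht)) i
    · exact (hasDerivWithinAt_pi.1 (h'.2 t ht)) i

lemma IsTrajectory.inl {z v : ℝ → ι ⊕ κ → ℝ} (h : IsTrajectory z v) :
    IsTrajectory (fun t i => z t (Sum.inl i)) (fun t i => v t (Sum.inl i)) :=
  ⟨continuousOn_pi.2 fun i => continuousOn_pi.1 h.1 (Sum.inl i), fun t ht =>
    hasDerivWithinAt_pi.2 fun i => hasDerivWithinAt_pi.1 (h.2 t ht) (Sum.inl i)⟩

lemma IsTrajectory.inr {z v : ℝ → ι ⊕ κ → ℝ} (h : IsTrajectory z v) :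
    IsTrajectory (fun t i => z t (Sum.inr i)) (fun t i => v t (Sum.inr i)) :=
  ⟨continuousOn_pi.2 fun i => continuousOn_pi.1 h.1 (Sum.inr i), fun t ht =>
    hasDerivWithinAt_pi.2 fun i => hasDerivWithinAt_pi.1 (h.2 t ht) (Sum.inr i)⟩

lemma IsTrajectory.derivWithin_eq {z v : ℝ → ι → ℝ} (h : IsTrajectory z v) {t : ℝ} (ht : 0 ≤ t) :
    derivWithin z (Set.Ici t) t = v t :=
  (h.2 t ht).derivWithin (uniqueDiffWithinAt_Ici t)

lemma exists_hasDerivAt_mulVec (M : Matrix ι ι ℝ) (z₀ : ι → ℝ) :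
    ∃ z : ℝ → ι → ℝ, z 0 = z₀ ∧ ∀ t, HasDerivAt z (M *ᵥ z t) t := by
  let L : (ι → ℝ) →L[ℝ] (ι → ℝ) := LinearMap.toContinuousLinearMap M.mulVecLin
  refine ⟨fun t => NormedSpace.exp (t • L) z₀, by simp, fun t => ?_⟩
  exact (hasDerivAt_exp_smul_const' L t).clm_apply (hasDerivAt_const t z₀) |>.congr_deriv (by
    simp [L])

lemma IsTrajectory.eq_of_mulVec {M : Matrix ι ι ℝ} {z z' : ℝ → ι → ℝ}
    (h : IsTrajectory z fun t => M *ᵥ z t) (h' : IsTrajectory z' fun t => M *ᵥ z' t)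
    (h0 : z 0 = z' 0) {t : ℝ} (ht : 0 ≤ t) : z t = z' t :=
  ODE_solution_unique_of_mem_Icc_right (a := 0) (b := t) (s := fun _ => Set.univ)
    (v := fun _ y => M *ᵥ y)
    (fun _ _ => ((LinearMap.toContinuousLinearMap M.mulVecLin).lipschitz).lipschitzOnWith)
    (h.1.mono Set.Icc_subset_Ici_self) (fun s hs => h.2 s hs.1) (fun _ _ => trivial)
    (h'.1.mono Set.Icc_subset_Ici_self) (fun s hs => h'.2 s hs.1) (fun _ _ => trivial) h0
    ⟨ht, le_rfl⟩

/-- The components of a trajectory along a vector `v` that the velocity reproduces up to the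
factor `l` evolve as `e^{lt}`. -/
lemma IsTrajectory.dotProduct_eq_exp {z vel : ℝ → ι → ℝ} (h : IsTrajectory z vel) (v : ι → ℂ)
    (l : ℂ) (hv : ∀ t, 0 ≤ t →
      v ⬝ᵥ (fun i => (vel t i : ℂ)) = l * (v ⬝ᵥ fun i => (z t i : ℂ))) {t : ℝ} (ht : 0 ≤ t) :
    v ⬝ᵥ (fun i => (z t i : ℂ)) = (v ⬝ᵥ fun i => (z 0 i : ℂ)) * Complex.exp (l * t) := by
  have hexp : ∀ s : ℝ, HasDerivAt (fun s : ℝ => Complex.exp (-l * s))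
      (Complex.exp (-l * s) * (-l * 1)) s := fun s =>
    ((Complex.ofRealCLM.hasDerivAt (x := s)).const_mul (-l)).cexp
  have hz : ∀ s, 0 ≤ s → HasDerivWithinAt (fun s => v ⬝ᵥ (fun i => (z s i : ℂ)))
      (v ⬝ᵥ (fun i => (vel s i : ℂ))) (Set.Ici s) s := fun s hs => by
    simp only [dotProduct]
    refine HasDerivWithinAt.fun_sum fun i _ => HasDerivWithinAt.const_mul _ ?_
    exact (hasDerivWithinAt_pi.1 (h.2 s hs) i).ofReal_comp
  have hc : ContinuousOn (fun s => v ⬝ᵥ (fun i => (z s i : ℂ))) (Set.Ici 0) := by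
    simp only [dotProduct]
    refine continuousOn_finsetSum _ fun i _ => continuousOn_const.mul ?_
    exact Complex.continuous_ofReal.comp_continuousOn (continuousOn_pi.1 h.1 i)
  have key := constant_of_has_deriv_right_zero (a := 0) (b := t)
    (f := fun s => (v ⬝ᵥ (fun i => (z s i : ℂ))) * Complex.exp (-l * s))
    ((hc.mono Set.Icc_subset_Ici_self).mul (by fun_prop))
    (fun s hs => by
      refine ((hz s hs.1).mul (hexp s).hasDerivWithinAt).congr_deriv ?_
      rw [hv s hs.1]; ring) t ⟨ht, le_rfl⟩
  have hk : (v ⬝ᵥ (fun i => (z t i : ℂ))) * Complex.exp (-l * t)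
      = v ⬝ᵥ (fun i => (z 0 i : ℂ)) := by simpa using key
  rw [← hk, mul_assoc, ← Complex.exp_add]
  simp

lemma eq_zero_of_periodic_of_tendsto {E : Type*} [TopologicalSpace E] [T2Space E] [Zero E]
    {f : ℝ → E} {D : ℝ} (hD : 0 < D) (hf : Function.Periodic f D) (h : Tendsto f atTop (𝓝 0))
    (t : ℝ) : f t = 0 := by
  have h1 : Tendsto (fun k : ℕ => t + k * D) atTop atTop :=
    tendsto_atTop_add_const_left _ _ (tendsto_natCast_atTop_atTop.atTop_mul_const hD)
  have h2 : (fun k : ℕ => f (t + k * D)) = fun _ => f t := by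
    funext k
    simpa using hf.nat_mul k t
  have h3 : Tendsto (fun k : ℕ => f (t + k * D)) atTop (𝓝 0) := h.comp h1
  rw [h2] at h3
  exact tendsto_nhds_unique tendsto_const_nhds h3

end Trajectories

end OutReg

/-! ### Lyapunov's stability criterion -/

namespace OutReg

section Lyapunov

variable {ι : Type} [Fintype ι]

lemma dotProduct_mulVec_smul_smul (M : Matrix ι ι ℝ) (c : ℝ) (y : ι → ℝ) :
    (c • y) ⬝ᵥ (M *ᵥ (c • y)) = c ^ 2 * (y ⬝ᵥ (M *ᵥ y)) := by
  simp only [mulVec_smul, smul_dotProduct, dotProduct_smul, smul_eq_mul]; ring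

/-- Any quadratic form is dominated by a positive definite one, by compactness of the unit
sphere. -/
lemma _root_.Matrix.PosDef.exists_dotProduct_mulVec_le {W : Matrix ι ι ℝ} (hW : W.PosDef)
    (M : Matrix ι ι ℝ) : ∃ C > 0, ∀ y, y ⬝ᵥ (M *ᵥ y) ≤ C * (y ⬝ᵥ (W *ᵥ y)) := by
  have hpos : ∀ y : ι → ℝ, y ≠ 0 → 0 < y ⬝ᵥ (W *ᵥ y) := fun y hy => by
    simpa using hW.dotProduct_mulVec_pos hy
  have hcont : ContinuousOn (fun y : ι → ℝ => y ⬝ᵥ (M *ᵥ y) / (y ⬝ᵥ (W *ᵥ y)))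
      (Metric.sphere 0 1) := by
    refine ContinuousOn.div (by fun_prop) (by fun_prop) fun y hy => (hpos y ?_).ne'
    rintro rfl
    simp at hy
  obtain ⟨C, hC⟩ := ((isCompact_sphere (0 : ι → ℝ) 1).image_of_continuousOn hcont).bddAbove
  refine ⟨max C 1, by positivity, fun y => ?_⟩
  by_cases hy : y = 0
  · simp [hy]
  have hn : ‖y‖ ≠ 0 := norm_ne_zero_iff.2 hy
  have hm : ‖y‖⁻¹ • y ∈ Metric.sphere (0 : ι → ℝ) 1 := by simp [norm_smul, hn]
  have h1 := hC ⟨_, hm, rfl⟩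
  simp only [dotProduct_mulVec_smul_smul] at h1
  rw [mul_div_mul_left _ _ (by positivity), div_le_iff₀ (hpos y hy)] at h1
  exact h1.trans (mul_le_mul_of_nonneg_right (le_max_left _ _) (hpos y hy).le)

lemma sq_norm_le_dotProduct_self (y : ι → ℝ) : ‖y‖ ^ 2 ≤ y ⬝ᵥ y := by
  have h0 : 0 ≤ y ⬝ᵥ y := Finset.sum_nonneg fun i _ => mul_self_nonneg (y i)
  rw [← Real.sqrt_le_sqrt_iff h0, Real.sqrt_sq (norm_nonneg _)]
  refine (pi_norm_le_iff_of_nonneg (Real.sqrt_nonneg _)).2 fun i => ?_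
  refine Real.le_sqrt_of_sq_le ?_
  rw [Real.norm_eq_abs, sq_abs, sq]
  exact Finset.single_le_sum (f := fun i => y i * y i) (fun i _ => mul_self_nonneg (y i))
    (Finset.mem_univ i)

lemma dotProduct_mulVec_add_transpose (M : Matrix ι ι ℝ) (y : ι → ℝ) :
    y ⬝ᵥ ((M + Mᵀ) *ᵥ y) = 2 * (y ⬝ᵥ (M *ᵥ y)) := by
  rw [add_mulVec, dotProduct_add, mulVec_transpose, ← dotProduct_comm (y ᵥ* M),
    ← dotProduct_mulVec]
  ring

/-- If `A X + X Aᵀ ≺ 0` with `X ≻ 0`, the Lyapunov function `z ⬝ X⁻¹ z` decays exponentially along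
every trajectory of `ż = A z`. -/
lemma exists_exp_decay_of_lyapunov [DecidableEq ι] {A X : Matrix ι ι ℝ} (hX : X.PosDef)
    (hA : (-(A * X + (A * X)ᵀ)).PosDef) :
    ∃ c > 0, ∀ z : ℝ → ι → ℝ, IsTrajectory z (fun t => A *ᵥ z t) → ∀ t, 0 ≤ t →
      z t ⬝ᵥ (X⁻¹ *ᵥ z t) ≤ z 0 ⬝ᵥ (X⁻¹ *ᵥ z 0) * Real.exp (-c * t) := by
  obtain ⟨C, hC, hCle⟩ := hA.exists_dotProduct_mulVec_le X
  have hXu : IsUnit X.det := (isUnit_iff_isUnit_det X).1 hX.isUnit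
  have hXi : (X⁻¹)ᵀ = X⁻¹ := by simpa [IsHermitian] using hX.inv.isHermitian
  refine ⟨C⁻¹, by positivity, fun z hz t ht => ?_⟩
  have hV : ∀ s, 0 ≤ s → HasDerivWithinAt (fun s => z s ⬝ᵥ (X⁻¹ *ᵥ z s))
      ((A *ᵥ z s) ⬝ᵥ (X⁻¹ *ᵥ z s) + z s ⬝ᵥ (X⁻¹ *ᵥ (A *ᵥ z s))) (Set.Ici s) s := fun s hs => by
    have h1 := hasDerivWithinAt_pi.1 (hz.2 s hs)
    have h2 := hasDerivWithinAt_pi.1 ((hz.mulVec X⁻¹).2 s hs)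
    simp only [dotProduct, ← Finset.sum_add_distrib]
    exact HasDerivWithinAt.fun_sum fun i _ => (h1 i).mul (h2 i)
  have hbound : ∀ s, (A *ᵥ z s) ⬝ᵥ (X⁻¹ *ᵥ z s) + z s ⬝ᵥ (X⁻¹ *ᵥ (A *ᵥ z s))
      ≤ -C⁻¹ * (z s ⬝ᵥ (X⁻¹ *ᵥ z s)) := fun s => by
    obtain ⟨y, hy⟩ : ∃ y, z s = X *ᵥ y := ⟨X⁻¹ *ᵥ z s, by simp [mul_nonsing_inv _ hXu]⟩
    have h1 : X⁻¹ *ᵥ z s = y := by simp [hy, nonsing_inv_mul _ hXu]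
    have h2 := hCle y
    rw [neg_mulVec, dotProduct_neg, dotProduct_mulVec_add_transpose] at h2
    have h3 : z s ⬝ᵥ (X⁻¹ *ᵥ (A *ᵥ z s)) = y ⬝ᵥ ((A * X) *ᵥ y) := by
      rw [dotProduct_mulVec, ← mulVec_transpose, hXi, h1, hy, mulVec_mulVec]
    have h4 : (A *ᵥ z s) ⬝ᵥ (X⁻¹ *ᵥ z s) = y ⬝ᵥ ((A * X) *ᵥ y) := by
      rw [h1, dotProduct_comm, hy, mulVec_mulVec]
    have h5 : z s ⬝ᵥ (X⁻¹ *ᵥ z s) = y ⬝ᵥ (X *ᵥ y) := by rw [h1, dotProduct_comm, hy]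
    rw [h3, h4, h5]
    have h6 := mul_le_mul_of_nonneg_left h2 (inv_pos.2 hC).le
    rw [← mul_assoc, inv_mul_cancel₀ hC.ne'] at h6
    linarith
  have hVc : ContinuousOn (fun s => z s ⬝ᵥ (X⁻¹ *ᵥ z s)) (Set.Ici 0) := by
    simp only [dotProduct]
    exact continuousOn_finsetSum _ fun i _ =>
      (continuousOn_pi.1 hz.1 i).mul (continuousOn_pi.1 (hz.mulVec X⁻¹).1 i)
  have := le_gronwallBound_of_liminf_deriv_right_le (a := 0) (b := t) (ε := 0) (K := -C⁻¹)
    (hVc.mono Set.Icc_subset_Ici_self)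
    (fun s hs r hr => (hV s hs.1).liminf_right_slope_le hr) le_rfl
    (fun s hs => by simpa using hbound s) t ⟨ht, le_rfl⟩
  simpa [gronwallBound_ε0] using this

lemma exists_norm_sq_le_of_lyapunov [DecidableEq ι] {A X : Matrix ι ι ℝ} (hX : X.PosDef)
    (hA : (-(A * X + (A * X)ᵀ)).PosDef) :
    ∃ c > 0, ∃ C > 0, ∀ z : ℝ → ι → ℝ, IsTrajectory z (fun t => A *ᵥ z t) → ∀ t, 0 ≤ t →
      ‖z t‖ ^ 2 ≤ C * (z 0 ⬝ᵥ (X⁻¹ *ᵥ z 0)) * Real.exp (-c * t) := by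
  obtain ⟨c, hc, h⟩ := exists_exp_decay_of_lyapunov hX hA
  obtain ⟨C, hC, hCle⟩ := hX.inv.exists_dotProduct_mulVec_le 1
  refine ⟨c, hc, C, hC, fun z hz t ht => ?_⟩
  calc ‖z t‖ ^ 2 ≤ z t ⬝ᵥ z t := sq_norm_le_dotProduct_self _
    _ ≤ C * (z t ⬝ᵥ (X⁻¹ *ᵥ z t)) := by simpa using hCle (z t)
    _ ≤ _ := by rw [mul_assoc]; exact mul_le_mul_of_nonneg_left (h z hz t ht) hC.le

lemma tendsto_zero_of_lyapunov [DecidableEq ι] {A X : Matrix ι ι ℝ} (hX : X.PosDef)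
    (hA : (-(A * X + (A * X)ᵀ)).PosDef) {z : ℝ → ι → ℝ} (hz : IsTrajectory z fun t => A *ᵥ z t) :
    Tendsto z atTop (𝓝 0) := by
  obtain ⟨c, hc, C, -, h⟩ := exists_norm_sq_le_of_lyapunov hX hA
  have h1 : Tendsto (fun t => C * (z 0 ⬝ᵥ (X⁻¹ *ᵥ z 0)) * Real.exp (-c * t)) atTop (𝓝 0) := by
    have h2 : Tendsto (fun t : ℝ => Real.exp (-c * t)) atTop (𝓝 0) :=
      Real.tendsto_exp_atBot.comp (tendsto_id.const_mul_atTop_of_neg (neg_lt_zero.2 hc))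
    simpa using h2.const_mul (C * (z 0 ⬝ᵥ (X⁻¹ *ᵥ z 0)))
  have h3 : Tendsto (fun t => ‖z t‖ ^ 2) atTop (𝓝 0) :=
    squeeze_zero' (Eventually.of_forall fun t => sq_nonneg _)
      ((eventually_ge_atTop 0).mono fun t ht => h z hz t ht) h1
  rw [tendsto_zero_iff_norm_tendsto_zero]
  simpa [Real.sqrt_sq] using h3.sqrt

lemma stable_of_lyapunov [DecidableEq ι] {A X : Matrix ι ι ℝ} (hX : X.PosDef)
    (hA : (-(A * X + (A * X)ᵀ)).PosDef) {ε : ℝ} (hε : 0 < ε) :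
    ∃ δ > 0, ∀ z : ℝ → ι → ℝ, IsTrajectory z (fun t => A *ᵥ z t) → ‖z 0‖ < δ →
      ∀ t, 0 ≤ t → ‖z t‖ < ε := by
  obtain ⟨c, hc, C, hC, h⟩ := exists_norm_sq_le_of_lyapunov hX hA
  have hcont : Continuous fun y : ι → ℝ => C * (y ⬝ᵥ (X⁻¹ *ᵥ y)) := by fun_prop
  have hev : ∀ᶠ y in 𝓝 (0 : ι → ℝ), C * (y ⬝ᵥ (X⁻¹ *ᵥ y)) < ε ^ 2 :=
    hcont.continuousAt.eventually_lt_const (by simpa using by positivity)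
  obtain ⟨δ, hδ, hball⟩ := Metric.eventually_nhds_iff.1 hev
  refine ⟨δ, hδ, fun z hz h0 t ht => ?_⟩
  have h1 := hball (y := z 0) (by simpa using h0)
  have h2 : 0 ≤ C * (z 0 ⬝ᵥ (X⁻¹ *ᵥ z 0)) := by
    have := hX.inv.posSemidef.dotProduct_mulVec_nonneg (z 0)
    exact mul_nonneg hC.le (by simpa using this)
  have h3 : Real.exp (-c * t) ≤ 1 := Real.exp_le_one_iff.2 (by nlinarith)
  refine lt_of_pow_lt_pow_left₀ 2 hε.le ?_
  calc ‖z t‖ ^ 2 ≤ _ := h z hz t ht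
    _ ≤ C * (z 0 ⬝ᵥ (X⁻¹ *ᵥ z 0)) := mul_le_of_le_one_right h2 h3
    _ < ε ^ 2 := h1

end Lyapunov

end OutReg

/-! ### The closed loop as a linear system -/

namespace OutReg

section ClosedLoopMatrix

variable {nw n m p : ℕ} {κ : Type} [Fintype κ]

/-- State matrix of the closed loop in the coordinates `(x, ξ)`. -/
def closedLoopA (Pl : Plant nw n m p) (R : Regulator n m p κ) : Matrix (Fin n ⊕ κ) (Fin n ⊕ κ) ℝ :=
  fromBlocks (Pl.A + Pl.B * (R.He * Pl.Ce + R.Hx)) (Pl.B * R.H) (R.Fe * Pl.Ce + R.Fx) R.F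

/-- Matrix through which the exosystem state enters the closed loop. -/
def closedLoopP (Pl : Plant nw n m p) (R : Regulator n m p κ) : Matrix (Fin n ⊕ κ) (Fin nw) ℝ :=
  fromRows (Pl.P + Pl.B * (R.He * Pl.Qe)) (R.Fe * Pl.Qe)

lemma closedLoop_velocity (Pl : Plant nw n m p) (R : Regulator n m p κ) (w : Fin nw → ℝ)
    (x : Fin n → ℝ) (ξ : κ → ℝ) :
    closedLoopA Pl R *ᵥ Sum.elim x ξ + closedLoopP Pl R *ᵥ w =
      Sum.elim (Pl.A *ᵥ x + Pl.B *ᵥ R.control ξ (Pl.err w x) x + Pl.P *ᵥ w)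
        (R.F *ᵥ ξ + R.Fe *ᵥ Pl.err w x + R.Fx *ᵥ x) := by
  rw [closedLoopA, closedLoopP, fromBlocks_mulVec, fromRows_mulVec]
  ext (i | i) <;>
  · simp only [Sum.elim_comp_inl, Sum.elim_comp_inr, Pi.add_apply, Sum.elim_inl, Sum.elim_inr,
      Regulator.control, Plant.err, add_mulVec, mulVec_add, Matrix.mul_add, ← mulVec_mulVec]
    ring

lemma IsClosedLoop.isTrajectory {Pl : Plant nw n m p} {R : Regulator n m p κ}
    {w : ℝ → Fin nw → ℝ} {x : ℝ → Fin n → ℝ} {ξ : ℝ → κ → ℝ} (h : IsClosedLoop Pl R w x ξ) :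
    IsTrajectory (fun t => Sum.elim (x t) (ξ t))
      (fun t => closedLoopA Pl R *ᵥ Sum.elim (x t) (ξ t) + closedLoopP Pl R *ᵥ w t) :=
  (h.plant.sumElim h.regulator).congr_velocity fun _ _ => (closedLoop_velocity _ _ _ _ _).symm

lemma IsTrajectory.isClosedLoop {Pl : Plant nw n m p} {R : Regulator n m p κ}
    {w : ℝ → Fin nw → ℝ} {z : ℝ → Fin n ⊕ κ → ℝ}
    (h : IsTrajectory z (fun t => closedLoopA Pl R *ᵥ z t + closedLoopP Pl R *ᵥ w t)) :
    IsClosedLoop Pl R w (fun t i => z t (Sum.inl i)) (fun t i => z t (Sum.inr i)) := by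
  have hz : ∀ t, z t = Sum.elim (fun i => z t (Sum.inl i)) (fun i => z t (Sum.inr i)) := fun t => by
    ext (i | i) <;> rfl
  have h' := h.congr_velocity fun t _ => (congrArg (fun y => closedLoopA Pl R *ᵥ y +
    closedLoopP Pl R *ᵥ w t) (hz t)).trans (closedLoop_velocity _ _ _ _ _)
  exact ⟨h'.inl, h'.inr⟩

end ClosedLoopMatrix

/-! ### The Sylvester equation -/

/-- For a periodic exosystem and an attractive `A` the Sylvester equation `Π S = A Π + P` is
solvable. The operator `Π ↦ Π S - A Π` acts on a finite-dimensional space and is injective: if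
`Π S = A Π`, then `Π w` is, for every exosystem solution `w`, a periodic solution of `ż = A z`. -/
lemma exists_sylvester {nw : ℕ} {S : Matrix (Fin nw) (Fin nw) ℝ} (hS : ExosystemPeriodic S)
    {ι : Type} [Fintype ι] {A : Matrix ι ι ℝ}
    (hA : ∀ z : ℝ → ι → ℝ, IsTrajectory z (fun t => A *ᵥ z t) → Tendsto z atTop (𝓝 0))
    (P : Matrix ι (Fin nw) ℝ) : ∃ Q : Matrix ι (Fin nw) ℝ, Q * S = A * Q + P := by
  let L : Matrix ι (Fin nw) ℝ →ₗ[ℝ] Matrix ι (Fin nw) ℝ :=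
    { toFun := fun Q => Q * S - A * Q
      map_add' := fun Q Q' => by rw [Matrix.add_mul, Matrix.mul_add]; abel
      map_smul' := fun c Q => by simp [smul_sub] }
  have hL : Function.Injective L := by
    rw [injective_iff_map_eq_zero]
    intro Q hQ
    have hQ' : Q * S = A * Q := sub_eq_zero.1 hQ
    refine mulVec_injective (funext fun w₀ => ?_)
    obtain ⟨w, hw0, hw⟩ := exists_hasDerivAt_mulVec S w₀
    obtain ⟨-, D, hD, hper⟩ := hS w hw
    have h1 : IsTrajectory (fun t => Q *ᵥ w t) (fun t => A *ᵥ (Q *ᵥ w t)) :=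
      IsTrajectory.of_hasDerivAt fun t => by
        rw [mulVec_mulVec, ← hQ', ← mulVec_mulVec]
        exact hasDerivAt_mulVec (hw t) Q
    have h2 := eq_zero_of_periodic_of_tendsto hD (hper.comp fun y => Q *ᵥ y) (hA _ h1) 0
    simpa [hw0] using h2
  obtain ⟨Q, hQ⟩ := LinearMap.surjective_of_injective hL P
  exact ⟨Q, by rw [← hQ]; simp [L]⟩

/-! ### The internal model -/

open Polynomial in
/-- A family that is shifted by `f` and closed up by the coefficients of a monic polynomial `q`, up
to an error `e`, consists of the iterates of its first member, and `q(f)` maps that to `e`. -/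
lemma aeval_apply_of_companion_chain {V : Type*} [AddCommGroup V] [Module ℝ V] {q : ℝ[X]}
    (hq : q.Monic) (f : Module.End ℝ V) (r : Fin q.natDegree → V) (e : V) (hd : 0 < q.natDegree)
    (hstep : ∀ (i : Fin q.natDegree) (h : (i : ℕ) + 1 < q.natDegree), f (r i) = r ⟨i + 1, h⟩)
    (hlast : ∀ i : Fin q.natDegree, (i : ℕ) + 1 = q.natDegree →
      f (r i) = -(∑ k : Fin q.natDegree, q.coeff k • r k) + e) :
    (∀ i : Fin q.natDegree, r i = (f ^ (i : ℕ)) (r ⟨0, hd⟩)) ∧ aeval f q (r ⟨0, hd⟩) = e := by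
  have h1 : ∀ (i : ℕ) (h : i < q.natDegree), r ⟨i, h⟩ = (f ^ i) (r ⟨0, hd⟩) := by
    intro i
    induction i with
    | zero => intro h; simp
    | succ k ih =>
      intro h
      rw [← hstep ⟨k, by omega⟩ h, ih (by omega), pow_succ', Module.End.mul_apply]
  refine ⟨fun i => h1 i i.2, ?_⟩
  have h2 := hlast ⟨q.natDegree - 1, by omega⟩ (by simp; omega)
  rw [h1, ← Module.End.mul_apply, ← pow_succ', Nat.sub_add_cancel hd] at h2
  rw [aeval_eq_sum_range, Finset.sum_range_succ, hq.coeff_natDegree, one_smul,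
    LinearMap.add_apply, h2, Finset.sum_range, LinearMap.sum_apply]
  simp only [LinearMap.smul_apply]
  rw [Finset.sum_congr rfl fun k _ => by rw [← h1 k k.2]]
  abel

section InternalModel

variable {nw : ℕ} (S : Matrix (Fin nw) (Fin nw) ℝ) (p : ℕ)

lemma minpoly_matrix_monic : (minpoly ℝ S).Monic := minpoly.monic (Matrix.isIntegral S)

lemma map_imΦ_mulVec_of_lt {R : Type*} [CommRing R] (f : ℝ →+* R) (y : ImIdx S p → R)
    (i : Fin (minpoly ℝ S).natDegree) (a : Fin p) (h : (i : ℕ) + 1 < (minpoly ℝ S).natDegree) :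
    ((imΦ S p).map f *ᵥ y) (i, a) = y (⟨i + 1, h⟩, a) := by
  rw [mulVec, dotProduct, Finset.sum_eq_single (⟨(i : ℕ) + 1, h⟩, a)]
  · simp [imΦ, h.ne]
  · rintro ⟨k, b⟩ - hkb
    simp only [imΦ, map_apply, of_apply, if_neg h.ne]
    split_ifs with h1 h2
    · exact absurd (Prod.ext (Fin.ext h2) h1.symm) hkb
    · simp
    · simp
  · simp

lemma map_imΦ_mulVec_of_eq {R : Type*} [CommRing R] (f : ℝ →+* R) (y : ImIdx S p → R)
    (i : Fin (minpoly ℝ S).natDegree) (a : Fin p) (h : (i : ℕ) + 1 = (minpoly ℝ S).natDegree) :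
    ((imΦ S p).map f *ᵥ y) (i, a) =
      -∑ k : Fin (minpoly ℝ S).natDegree, f ((minpoly ℝ S).coeff k) * y (k, a) := by
  rw [mulVec, dotProduct, Fintype.sum_prod_type, ← Finset.sum_neg_distrib]
  refine Finset.sum_congr rfl fun k _ => ?_
  rw [Finset.sum_eq_single a]
  · simp [imΦ, h]
  · intro b _ hb
    simp [imΦ, Ne.symm hb]
  · simp

lemma aeval_vecMulLinear_apply (q : Polynomial ℝ) (r : Fin nw → ℝ) :
    Polynomial.aeval (S.vecMulLinear : Module.End ℝ (Fin nw → ℝ)) q r =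
      r ᵥ* Polynomial.aeval S q := by
  have hpow : ∀ k : ℕ, ((S.vecMulLinear : Module.End ℝ (Fin nw → ℝ)) ^ k) r = r ᵥ* S ^ k := by
    intro k
    induction k with
    | zero => simp
    | succ k ih => rw [pow_succ', Module.End.mul_apply, ih, pow_succ]; simp
  rw [Polynomial.aeval_eq_sum_range, Polynomial.aeval_eq_sum_range, LinearMap.sum_apply,
    vecMul_sum]
  exact Finset.sum_congr rfl fun k _ => by rw [LinearMap.smul_apply, hpow, vecMul_smul]

variable {S p}

/-- In steady state the internal model admits no error: the block rows of `Π` satisfy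
`Πᵢ₊₁ = Πᵢ S`, and the last of them turns `E` into `Π₁ m_S(S) = 0`. -/
lemma eq_zero_of_internalModel_sylvester {Q : Matrix (ImIdx S p) (Fin nw) ℝ}
    {E : Matrix (Fin p) (Fin nw) ℝ} (h : Q * S = imΦ S p * Q + imG S p * E) : E = 0 := by
  rcases Nat.eq_zero_or_pos (minpoly ℝ S).natDegree with hd | hd
  · -- a minimal polynomial of degree zero is `1`, and then the exosystem has dimension zero
    have h1 : (minpoly ℝ S) = 1 := (minpoly_matrix_monic S).natDegree_eq_zero.1 hd
    have h2 : (1 : Matrix (Fin nw) (Fin nw) ℝ) = 0 := by simpa [h1] using minpoly.aeval ℝ S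
    rw [← Matrix.mul_one E, h2, Matrix.mul_zero]
  ext a j
  have hG : ∀ (i : Fin (minpoly ℝ S).natDegree) j, (imG S p * E) (i, a) j =
      if (i : ℕ) + 1 = (minpoly ℝ S).natDegree then E a j else 0 := fun i j => by
    rw [Matrix.mul_apply]
    split_ifs with hi <;> simp [imG, hi]
  have hΦ : ∀ (i : Fin (minpoly ℝ S).natDegree) j, (imΦ S p * Q) (i, a) j =
      ((imΦ S p).map (RingHom.id ℝ) *ᵥ Q.col j) (i, a) := fun i j => by
    simp [Matrix.mul_apply, mulVec, dotProduct]
  have hrow : ∀ (i : Fin (minpoly ℝ S).natDegree) j,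
      (Q.row (i, a) ᵥ* S) j = (imΦ S p * Q) (i, a) j + (imG S p * E) (i, a) j := fun i j => by
    rw [← Matrix.add_apply, ← h, Matrix.mul_apply]; rfl
  have key := (aeval_apply_of_companion_chain (minpoly_matrix_monic S)
    (S.vecMulLinear : Module.End ℝ (Fin nw → ℝ)) (fun i => Q.row (i, a)) (E.row a) hd
    (fun i hi => by
      ext j
      rw [vecMulLinear_apply, hrow, hG, if_neg hi.ne, add_zero, hΦ,
        map_imΦ_mulVec_of_lt _ _ _ _ _ _ hi]
      rfl)
    (fun i hi => by
      ext j
      rw [vecMulLinear_apply, hrow, hG, if_pos hi, hΦ, map_imΦ_mulVec_of_eq _ _ _ _ _ _ hi]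
      simp)).2
  rw [aeval_vecMulLinear_apply, minpoly.aeval, vecMul_zero] at key
  exact (congrFun key j).symm

/-- Every eigenvalue of the internal model is a root of the minimal polynomial of `S`. -/
lemma eq_zero_of_vecMul_map_imΦ {v : ImIdx S p → ℂ} {l : ℂ}
    (hl : Polynomial.aeval l (minpoly ℝ S) ≠ 0)
    (hv : v ᵥ* (imΦ S p).map (algebraMap ℝ ℂ) = l • v) : v = 0 := by
  by_contra hne
  have hdet : ((imΦ S p).map (algebraMap ℝ ℂ) - l • (1 : Matrix (ImIdx S p) (ImIdx S p) ℂ)).det = 0 :=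
    exists_vecMul_eq_zero_iff.1 ⟨v, hne, by rw [vecMul_sub, hv, vecMul_smul, vecMul_one, sub_self]⟩
  obtain ⟨y, hy, hy0⟩ := exists_mulVec_eq_zero_iff.2 hdet
  rw [sub_mulVec, smul_mulVec, one_mulVec, sub_eq_zero] at hy0
  refine hy (funext fun ⟨i, a⟩ => ?_)
  have hd : 0 < (minpoly ℝ S).natDegree := i.pos
  obtain ⟨h1, h2⟩ := aeval_apply_of_companion_chain (minpoly_matrix_monic S)
    (Algebra.lmul ℝ ℂ l) (fun i => y (i, a)) 0 hd
    (fun i hi => by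
      have := congrFun hy0 (i, a)
      rw [map_imΦ_mulVec_of_lt _ _ _ _ _ _ hi] at this
      simpa using this.symm)
    (fun i hi => by
      have := congrFun hy0 (i, a)
      rw [map_imΦ_mulVec_of_eq _ _ _ _ _ _ hi] at this
      simpa using this.symm)
  rw [Polynomial.aeval_algHom_apply] at h2
  have h3 : y (⟨0, hd⟩, a) = 0 := by simpa [hl] using h2
  have h4 := h1 i
  simp only [h3, map_zero] at h4
  exact h4

end InternalModel

end OutReg

/-! ### Exosystem solutions are combinations of the modes -/

namespace OutReg

section Modes

variable {nw : ℕ} (S : Matrix (Fin nw) (Fin nw) ℝ)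

/-- Complex linear combinations of the (real) modes of the exosystem. -/
noncomputable def modeSpan : Submodule ℂ (ℝ → ℂ) :=
  Submodule.span ℂ (Set.range fun i : ModeIdx S => fun t : ℝ => (mode S i t : ℂ))

/-- The minimal polynomial of `S` over the complex numbers. -/
noncomputable abbrev complexMinpoly : Polynomial ℂ := (minpoly ℝ S).map (algebraMap ℝ ℂ)

lemma complexMinpoly_ne_zero : complexMinpoly S ≠ 0 :=
  ((minpoly_matrix_monic S).map _).ne_zero

lemma aeval_map_complexMinpoly :
    Polynomial.aeval (S.map (algebraMap ℝ ℂ)) (complexMinpoly S) = 0 := by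
  rw [Polynomial.aeval_map_algebraMap]
  have h := Polynomial.aeval_algHom_apply
    (AlgHom.mapMatrix (m := Fin nw) (Algebra.ofId ℝ ℂ)) S (minpoly ℝ S)
  rw [minpoly.aeval, map_zero] at h
  exact h

lemma blockOrder_conj (l : ℂ) : blockOrder S (starRingEnd ℂ l) = blockOrder S l := by
  have hmap : (complexMinpoly S).map (starRingEnd ℂ) = complexMinpoly S := by
    rw [Polynomial.map_map]
    congr 1
    ext x
    exact Complex.conj_ofReal x
  have h := Polynomial.eq_rootMultiplicity_map (p := complexMinpoly S) (f := starRingEnd ℂ)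
    (starRingEnd ℂ).injective l
  rw [hmap] at h
  exact h.symm

lemma blockOrder_pos_iff {l : ℂ} :
    0 < blockOrder S l ↔ Polynomial.aeval l (minpoly ℝ S) = 0 := by
  rw [blockOrder, Polynomial.rootMultiplicity_pos (complexMinpoly_ne_zero S), Polynomial.IsRoot.def,
    Polynomial.eval_map_algebraMap]

lemma mode_mem_modeSpan (i : ModeIdx S) : (fun t : ℝ => (mode S i t : ℂ)) ∈ modeSpan S :=
  Submodule.subset_span ⟨i, rfl⟩

/-- Complex exponential modes: `e^{(μ + iψ)t} = e^{μt} cos(ψt) + i e^{μt} sin(ψt)`. -/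
lemma pow_mul_cexp_mem_modeSpan {l : ℂ} {j : ℕ} (hj : j < blockOrder S l) :
    (fun t : ℝ => (t : ℂ) ^ j / (j ! : ℂ) * Complex.exp (l * t)) ∈ modeSpan S := by
  have hroot : Polynomial.aeval l (minpoly ℝ S) = 0 := (blockOrder_pos_iff S).1 (by omega)
  have hmem : ∀ z : ℂ, Polynomial.aeval z (minpoly ℝ S) = 0 → 0 < z.im → z ∈ complexEigs S :=
    fun z hz him => by
      rw [complexEigs, Finset.mem_filter, Multiset.mem_toFinset,
        Polynomial.mem_roots (complexMinpoly_ne_zero S), Polynomial.IsRoot.def,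
        Polynomial.eval_map_algebraMap]
      exact ⟨hz, him⟩
  have hexp : ∀ (z : ℂ) (t : ℝ), Complex.exp (z * t) = Real.exp (z.re * t) *
      (Real.cos (z.im * t) + Complex.I * Real.sin (z.im * t)) := fun z t => by
    conv_lhs => rw [← Complex.re_add_im z]
    rw [add_mul, Complex.exp_add, mul_right_comm, Complex.exp_mul_I]
    push_cast
    ring
  rcases lt_trichotomy l.im 0 with him | him | him
  · have hroot' : Polynomial.aeval (starRingEnd ℂ l) (minpoly ℝ S) = 0 := by
      rw [← blockOrder_pos_iff, blockOrder_conj, blockOrder_pos_iff, hroot]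
    let z : complexEigs S := ⟨starRingEnd ℂ l, hmem _ hroot' (by simpa using him)⟩
    let j' : Fin (blockOrder S (z : ℂ)) := ⟨j, by simpa [z, blockOrder_conj] using hj⟩
    have h := (modeSpan S).sub_mem (mode_mem_modeSpan S (Sum.inr ⟨z, j', 0⟩))
      ((modeSpan S).smul_mem Complex.I (mode_mem_modeSpan S (Sum.inr ⟨z, j', 1⟩)))
    convert h using 1
    funext t
    rw [hexp]
    simp [mode, z, j']
    ring
  · obtain ⟨r, rfl⟩ : ∃ r : ℝ, (r : ℂ) = l := ⟨l.re, Complex.ext rfl him.symm⟩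
    have hr : r ∈ realEigs S := by
      rw [realEigs, Multiset.mem_toFinset, Polynomial.mem_roots (minpoly_matrix_monic S).ne_zero,
        Polynomial.IsRoot.def, ← Polynomial.coe_aeval_eq_eval]
      exact (Polynomial.aeval_algebraMap_eq_zero_iff ℂ r (minpoly ℝ S)).1 hroot
    convert mode_mem_modeSpan S (Sum.inl ⟨⟨r, hr⟩, ⟨j, hj⟩⟩) using 1
    funext t
    simp [mode]
  · have h := (modeSpan S).add_mem
      (mode_mem_modeSpan S (Sum.inr ⟨⟨l, hmem l hroot him⟩, ⟨j, hj⟩, 0⟩))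
      ((modeSpan S).smul_mem Complex.I
        (mode_mem_modeSpan S (Sum.inr ⟨⟨l, hmem l hroot him⟩, ⟨j, hj⟩, 1⟩)))
    convert h using 1
    funext t
    rw [hexp]
    simp [mode]
    ring

/-- Generalized eigenvectors of `S` are annihilated by the power of `S - λ` given by the
multiplicity of `λ` in the minimal polynomial. -/
lemma pow_blockOrder_apply_eq_zero {l : ℂ} {v : Fin nw → ℂ}
    (hv : v ∈ Module.End.maxGenEigenspace (toLin' (S.map (algebraMap ℝ ℂ))) l) :
    ((toLin' (S.map (algebraMap ℝ ℂ)) - algebraMap ℂ _ l) ^ blockOrder S l) v = 0 := by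
  set g : Module.End ℂ (Fin nw → ℂ) := toLin' (S.map (algebraMap ℝ ℂ)) with hg
  obtain ⟨N, hN⟩ := Module.End.mem_maxGenEigenspace _ _ _ |>.1 hv
  have hgm : Polynomial.aeval g (complexMinpoly S) = 0 := by
    have h := Polynomial.aeval_algHom_apply
      (toLinAlgEquiv' : Matrix (Fin nw) (Fin nw) ℂ ≃ₐ[ℂ] _) (S.map (algebraMap ℝ ℂ))
      (complexMinpoly S)
    rw [aeval_map_complexMinpoly, map_zero] at h
    exact h
  obtain ⟨q, hq, hndvd⟩ := Polynomial.exists_eq_pow_rootMultiplicity_mul_and_not_dvd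
    (complexMinpoly S) (complexMinpoly_ne_zero S) l
  have hX : ∀ k : ℕ, Polynomial.aeval g ((Polynomial.X - Polynomial.C l) ^ k) =
      (g - algebraMap ℂ _ l) ^ k := fun k => by simp
  have hcop : IsCoprime ((Polynomial.X - Polynomial.C l) ^ N) q :=
    ((Polynomial.irreducible_X_sub_C l).coprime_iff_not_dvd.2 hndvd).pow_left
  have hdisj := Polynomial.disjoint_ker_aeval_of_isCoprime g hcop
  refine (Submodule.disjoint_def.1 hdisj) _ ?_ ?_
  · rw [LinearMap.mem_ker, hX, ← Module.End.mul_apply, ← pow_add, add_comm, pow_add,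
      Module.End.mul_apply]
    have : ((g - algebraMap ℂ _ l) ^ N) v = 0 := hN
    rw [this, map_zero]
  · rw [LinearMap.mem_ker, ← hX, ← Module.End.mul_apply, ← map_mul, mul_comm]
    have : (Polynomial.X - Polynomial.C l) ^ blockOrder S l * q = complexMinpoly S := hq.symm
    rw [this, hgm, LinearMap.zero_apply]

lemma hasDerivAt_pow_succ_mul_cexp (l : ℂ) (j : ℕ) (t : ℝ) :
    HasDerivAt (fun t : ℝ => (t : ℂ) ^ (j + 1) / ((j + 1)! : ℂ) * Complex.exp (l * t))
      (l * ((t : ℂ) ^ (j + 1) / ((j + 1)! : ℂ) * Complex.exp (l * t)) +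
        (t : ℂ) ^ j / (j ! : ℂ) * Complex.exp (l * t)) t := by
  have h0 : HasDerivAt (fun t : ℝ => (t : ℂ)) 1 t := Complex.ofRealCLM.hasDerivAt
  refine (((h0.pow (j + 1)).div_const _).mul (h0.const_mul l).cexp).congr_deriv ?_
  have h1 : ((j ! : ℕ) : ℂ) ≠ 0 := by exact_mod_cast Nat.factorial_ne_zero j
  have h2 : ((j : ℂ) + 1) ≠ 0 := by exact_mod_cast Nat.succ_ne_zero j
  simp only [Nat.factorial_succ]
  push_cast
  field_simp
  simp
  ring

/-- Through a generalized eigenvector `v` of a linear map `g` passes the solution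
`∑ⱼ tʲ/j! e^{λt} (g - λ)ʲ v` of `ḟ = g f`. -/
lemma hasDerivAt_sum_pow_mul_cexp {g : Module.End ℂ (Fin nw → ℂ)} {l : ℂ} {v : Fin nw → ℂ} {k : ℕ}
    (hv : ((g - algebraMap ℂ _ l) ^ k) v = 0) (t : ℝ) :
    HasDerivAt (fun t : ℝ => ∑ j ∈ Finset.range k,
        ((t : ℂ) ^ j / (j ! : ℂ) * Complex.exp (l * t)) • ((g - algebraMap ℂ _ l) ^ j) v)
      (g (∑ j ∈ Finset.range k,
        ((t : ℂ) ^ j / (j ! : ℂ) * Complex.exp (l * t)) • ((g - algebraMap ℂ _ l) ^ j) v)) t := by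
  set N : Module.End ℂ (Fin nw → ℂ) := g - algebraMap ℂ _ l with hN
  set F : ℕ → ℝ → Fin nw → ℂ := fun k t => ∑ j ∈ Finset.range k,
        ((t : ℂ) ^ j / (j ! : ℂ) * Complex.exp (l * t)) • (N ^ j) v with hF
  have hg : ∀ y, g y = l • y + N y := fun y => by
    simp [hN, Module.algebraMap_end_apply]
  have hFs : ∀ k t, F (k + 1) t =
      F k t + ((t : ℂ) ^ k / (k ! : ℂ) * Complex.exp (l * t)) • (N ^ k) v := fun k t =>
    Finset.sum_range_succ _ _
  have hder : ∀ k, HasDerivAt (F (k + 1)) (l • F (k + 1) t + N (F k t)) t := by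
    intro k
    induction k with
    | zero =>
      have h0 : HasDerivAt (fun t : ℝ => (t : ℂ)) 1 t := Complex.ofRealCLM.hasDerivAt
      have h1 := ((h0.const_mul l).cexp).smul_const v
      have h2 : F (0 + 1) = fun t : ℝ => Complex.exp (l * t) • v := by
        funext s; simp [hF]
      have h3 : F 0 t = 0 := by simp [hF]
      rw [h2, h3]
      refine h1.congr_deriv ?_
      simp [smul_smul, mul_comm]
    | succ k ih =>
      have h1 := ih.add ((hasDerivAt_pow_succ_mul_cexp l k t).smul_const ((N ^ (k + 1)) v))
      have h2 : F (k + 1 + 1) = F (k + 1) + fun t : ℝ =>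
          ((t : ℂ) ^ (k + 1) / ((k + 1)! : ℂ) * Complex.exp (l * t)) • (N ^ (k + 1)) v := by
        funext s; exact hFs _ _
      rw [h2]
      refine h1.congr_deriv ?_
      have h3 : N (F (k + 1) t) =
          N (F k t) + ((t : ℂ) ^ k / (k ! : ℂ) * Complex.exp (l * t)) • (N ^ (k + 1)) v := by
        rw [hFs k t, map_add, map_smul, ← Module.End.mul_apply N, ← pow_succ']
      rw [h3, Pi.add_apply, smul_add, add_smul, mul_smul l]
      abel
  rcases k with _ | k
  · simpa [hF] using hasDerivAt_const t (0 : Fin nw → ℂ)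
  · refine (hder k).congr_deriv ?_
    have h1 : N (F (k + 1) t) = N (F k t) := by
      rw [hFs k t, map_add, map_smul, ← Module.End.mul_apply N, ← pow_succ', hv, smul_zero,
        add_zero]
    exact ((hg (F (k + 1) t)).trans (by rw [h1])).symm

/-- Through every complex vector passes a solution of `ḟ = S f` whose components are combinations
of the modes. -/
lemma exists_solution_mem_modeSpan (v : Fin nw → ℂ) :
    ∃ f : ℝ → Fin nw → ℂ, f 0 = v ∧
      (∀ t, HasDerivAt f (toLin' (S.map (algebraMap ℝ ℂ)) (f t)) t) ∧
      ∀ i, (fun t => f t i) ∈ modeSpan S := by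
  set g : Module.End ℂ (Fin nw → ℂ) := toLin' (S.map (algebraMap ℝ ℂ)) with hg
  let V : Submodule ℂ (Fin nw → ℂ) :=
    { carrier := {v | ∃ f : ℝ → Fin nw → ℂ, f 0 = v ∧ (∀ t, HasDerivAt f (g (f t)) t) ∧
        ∀ i, (fun t => f t i) ∈ modeSpan S}
      add_mem' := by
        rintro _ _ ⟨f, rfl, hf, hfm⟩ ⟨f', rfl, hf', hfm'⟩
        exact ⟨f + f', rfl, fun t => ((hf t).add (hf' t)).congr_deriv (by simp),
          fun i => (modeSpan S).add_mem (hfm i) (hfm' i)⟩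
      zero_mem' := ⟨0, rfl, fun t => (hasDerivAt_const t 0).congr_deriv (by simp),
        fun i => (modeSpan S).zero_mem⟩
      smul_mem' := by
        rintro c _ ⟨f, rfl, hf, hfm⟩
        exact ⟨c • f, rfl, fun t => ((hf t).const_smul c).congr_deriv (by simp),
          fun i => (modeSpan S).smul_mem c (hfm i)⟩ }
  suffices h : (⊤ : Submodule ℂ (Fin nw → ℂ)) ≤ V from h (Submodule.mem_top (x := v))
  rw [← Module.End.iSup_maxGenEigenspace_eq_top g]
  refine iSup_le fun l v hv => ?_
  have hk := pow_blockOrder_apply_eq_zero S hv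
  refine ⟨_, ?_, hasDerivAt_sum_pow_mul_cexp hk, fun i => ?_⟩
  · rcases hb : blockOrder S l with _ | b
    · rw [hb] at hk
      simpa using hk.symm
    · rw [Finset.sum_range_succ', Finset.sum_eq_zero]
      · simp
      · intro j _
        simp
  · have h : (fun t : ℝ => (∑ j ∈ Finset.range (blockOrder S l),
        ((t : ℂ) ^ j / (j ! : ℂ) * Complex.exp (l * t)) • ((g - algebraMap ℂ _ l) ^ j) v) i) =
        ∑ j ∈ Finset.range (blockOrder S l), (((g - algebraMap ℂ _ l) ^ j) v i) •
          fun t : ℝ => (t : ℂ) ^ j / (j ! : ℂ) * Complex.exp (l * t) := by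
      funext t
      simp only [Finset.sum_apply, Pi.smul_apply, smul_eq_mul]
      exact Finset.sum_congr rfl fun j _ => mul_comm _ _
    rw [h]
    exact (modeSpan S).sum_mem fun j hj => (modeSpan S).smul_mem _
      (pow_mul_cexp_mem_modeSpan S (Finset.mem_range.1 hj))

/-- Every exosystem trajectory is a fixed linear image of the vector of modes. -/
lemma exists_eq_mulVec_mode {w : ℝ → Fin nw → ℝ} (hw : IsTrajectory w fun t => S *ᵥ w t) :
    ∃ L : Matrix (Fin nw) (ModeIdx S) ℝ, ∀ t, 0 ≤ t → w t = L *ᵥ fun i => mode S i t := by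
  obtain ⟨f, hf0, hf, hfm⟩ := exists_solution_mem_modeSpan S fun i => (w 0 i : ℂ)
  have hfm' : ∀ i, ∃ c : ModeIdx S → ℂ, ∑ k, c k • (fun t : ℝ => (mode S k t : ℂ)) =
      fun t => f t i := fun i => (Submodule.mem_span_range_iff_exists_fun ℂ).1 (hfm i)
  choose c hc using hfm'
  have hre : IsTrajectory (fun t i => (f t i).re) (fun t => S *ᵥ fun i => (f t i).re) :=
    IsTrajectory.of_hasDerivAt fun t => hasDerivAt_pi.2 fun i => by
      refine (Complex.reCLM.hasFDerivAt.comp_hasDerivAt t (hasDerivAt_pi.1 (hf t) i)).congr_deriv ?_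
      simp [mulVec, dotProduct]
  refine ⟨Matrix.of fun i k => (c i k).re, fun t ht => ?_⟩
  rw [hw.eq_of_mulVec hre (by funext i; simp [hf0]) ht]
  funext i
  have h := congrFun (hc i) t
  simp only [Finset.sum_apply, Pi.smul_apply, smul_eq_mul] at h
  rw [← h]
  simp [mulVec, dotProduct]

end Modes

end OutReg

/-! ### A linear matrix inequality for stabilizability -/

namespace OutReg

section LMI

variable {ι : Type} [Fintype ι]

/-- Positivity of the quadratic form of a matrix, without symmetry. -/
def PosQuad (M : Matrix ι ι ℝ) : Prop := ∀ y : ι → ℝ, y ≠ 0 → 0 < y ⬝ᵥ (M *ᵥ y)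

lemma isOpen_posQuad : IsOpen {M : Matrix ι ι ℝ | PosQuad M} := by
  rw [isOpen_iff_eventually]
  intro M hM
  have h := (isCompact_sphere (0 : ι → ℝ) 1).eventually_forall_of_forall_eventually (x₀ := M)
    (P := fun M y => 0 < y ⬝ᵥ (M *ᵥ y)) (fun y hy => by
      have hc : Continuous fun z : Matrix ι ι ℝ × (ι → ℝ) => z.2 ⬝ᵥ (z.1 *ᵥ z.2) := by fun_prop
      refine hc.continuousAt.eventually_const_lt (hM y ?_)
      rintro rfl
      simp at hy)
  refine h.mono fun M' hM' y hy => ?_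
  have hn : ‖y‖ ≠ 0 := norm_ne_zero_iff.2 hy
  have h1 := hM' (‖y‖⁻¹ • y) (by simp [norm_smul, hn])
  rw [dotProduct_mulVec_smul_smul] at h1
  exact pos_of_mul_pos_right h1 (by positivity)

lemma PosQuad.add {M M' : Matrix ι ι ℝ} (h : PosQuad M) (h' : ∀ y, 0 ≤ y ⬝ᵥ (M' *ᵥ y)) :
    PosQuad (M + M') := fun y hy => by
  rw [add_mulVec, dotProduct_add]
  exact add_pos_of_pos_of_nonneg (h y hy) (h' y)

lemma PosQuad.smul {M : Matrix ι ι ℝ} (h : PosQuad M) {c : ℝ} (hc : 0 < c) :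
    PosQuad (c • M) := fun y hy => by
  rw [smul_mulVec, dotProduct_smul]
  exact mul_pos hc (h y hy)

lemma PosQuad.posDef {M : Matrix ι ι ℝ} (h : PosQuad M) (hM : Mᵀ = M) : M.PosDef :=
  PosDef.of_dotProduct_mulVec_pos (by simpa [IsHermitian] using hM) fun {y} hy => by
    simpa using h y hy

lemma posQuad_one [DecidableEq ι] : PosQuad (1 : Matrix ι ι ℝ) := fun y hy => by
  simpa using (PosDef.one (n := ι) (R := ℝ)).dotProduct_mulVec_pos hy

variable {m : ℕ}

lemma convex_posQuad : Convex ℝ {M : Matrix ι ι ℝ | PosQuad M} := by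
  refine convex_iff_forall_pos.2 fun M hM M' hM' a b ha hb _ => ?_
  refine (PosQuad.smul hM ha).add fun y => ?_
  by_cases hy : y = 0
  · simp [hy]
  · exact (PosQuad.smul hM' hb y hy).le

/-- The pairs of matrices that have to be positive definite in the linear matrix inequality
`X ≻ 0`, `A X + B R + (A X + B R)ᵀ ≺ 0`. -/
def lmiSubspace (A : Matrix ι ι ℝ) (B : Matrix ι (Fin m) ℝ) :
    Submodule ℝ (Matrix ι ι ℝ × Matrix ι ι ℝ) where
  carrier := {P | ∃ (X : Matrix ι ι ℝ) (R : Matrix (Fin m) ι ℝ),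
    Xᵀ = X ∧ P = (X, -((A * X + B * R) + (A * X + B * R)ᵀ))}
  add_mem' := by
    rintro _ _ ⟨X, R, hX, rfl⟩ ⟨X', R', hX', rfl⟩
    refine ⟨X + X', R + R', by rw [transpose_add, hX, hX'], Prod.ext rfl ?_⟩
    simp only [Prod.mk_add_mk, Matrix.mul_add, transpose_add]
    abel
  zero_mem' := ⟨0, 0, transpose_zero, by ext <;> simp⟩
  smul_mem' := by
    rintro c _ ⟨X, R, hX, rfl⟩
    refine ⟨c • X, c • R, by rw [transpose_smul, hX], Prod.ext rfl ?_⟩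
    simp only [Prod.smul_mk, Matrix.mul_smul, transpose_add, transpose_smul, smul_neg, smul_add]

/-- An open convex set that misses a subspace lies strictly on one side of a hyperplane through that
subspace. -/
lemma exists_linearMap_pos_of_disjoint_submodule {E : Type*} [AddCommGroup E] [Module ℝ E]
    [TopologicalSpace E] [IsTopologicalAddGroup E] [ContinuousSMul ℝ E] {s : Set E}
    (hs : Convex ℝ s) (ho : IsOpen s) (V : Submodule ℝ E) (hd : Disjoint s (V : Set E)) :
    ∃ f : E →ₗ[ℝ] ℝ, (∀ x ∈ s, 0 < f x) ∧ ∀ x ∈ V, f x = 0 := by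
  obtain ⟨f, u, hfs, hft⟩ := geometric_hahn_banach_open hs ho V.convex hd
  have hu : u ≤ 0 := (hft 0 V.zero_mem).trans (map_zero f).le
  refine ⟨-f.toLinearMap, fun x hx => neg_pos.2 ((hfs x hx).trans_le hu),
    fun x hx => neg_eq_zero.2 ?_⟩
  by_contra! hne
  have hne' : f x ≠ 0 := hne
  have h := hft _ (V.smul_mem ((u - 1) / f x) hx)
  rw [map_smul, smul_eq_mul, div_mul_cancel₀ _ hne'] at h
  linarith

/-- If the linear matrix inequality has no solution, a hyperplane separates the open cone of pairs
of positive forms from the subspace of the candidate pairs. -/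
lemma exists_functional_of_not_exists_lmi [DecidableEq ι] (A : Matrix ι ι ℝ)
    (B : Matrix ι (Fin m) ℝ)
    (hno : ¬ ∃ (X : Matrix ι ι ℝ) (R : Matrix (Fin m) ι ℝ), X.PosDef ∧
      (-((A * X + B * R) + (A * X + B * R)ᵀ)).PosDef) :
    ∃ f : Matrix ι ι ℝ × Matrix ι ι ℝ →ₗ[ℝ] ℝ, 0 < f (1, 1) ∧
      (∀ P Q : Matrix ι ι ℝ, (∀ y, 0 ≤ y ⬝ᵥ (P *ᵥ y)) → (∀ y, 0 ≤ y ⬝ᵥ (Q *ᵥ y)) →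
        0 ≤ f (P, Q)) ∧
      ∀ P ∈ lmiSubspace A B, f P = 0 := by
  have hdisj : Disjoint ({M : Matrix ι ι ℝ | PosQuad M} ×ˢ {M : Matrix ι ι ℝ | PosQuad M})
      (lmiSubspace A B : Set (Matrix ι ι ℝ × Matrix ι ι ℝ)) := by
    rw [Set.disjoint_left]
    rintro _ ⟨h1, h2⟩ ⟨X, R, hX, rfl⟩
    exact hno ⟨X, R, PosQuad.posDef h1 hX, PosQuad.posDef h2 (by
      rw [transpose_neg, transpose_add, transpose_transpose, add_comm])⟩
  have hconv := (convex_posQuad (ι := ι)).prod (convex_posQuad (ι := ι))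
  have hopen := (isOpen_posQuad (ι := ι)).prod (isOpen_posQuad (ι := ι))
  obtain ⟨f, hfs, hf0⟩ := exists_linearMap_pos_of_disjoint_submodule hconv hopen _ hdisj
  have hf1 : 0 < f (1, 1) := hfs _ (Set.mk_mem_prod posQuad_one posQuad_one)
  refine ⟨f, hf1, fun P Q h1 h2 => ?_, hf0⟩
  -- A pair of nonnegative forms becomes positive when a positive multiple of `(1, 1)` is added.
  by_contra! hneg
  have hc : 0 < -f (P, Q) / f (1, 1) := div_pos (neg_pos.2 hneg) hf1
  generalize hcdef : -f (P, Q) / f (1, 1) = c at hc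
  have h := hfs (c • 1 + P, c • 1 + Q)
    (Set.mk_mem_prod ((posQuad_one.smul hc).add h1) ((posQuad_one.smul hc).add h2))
  rw [← Prod.mk_add_mk, ← Prod.smul_mk, map_add, map_smul, smul_eq_mul, ← hcdef,
    div_mul_cancel₀ _ hf1.ne'] at h
  linarith

/-- A linear functional on symmetric matrices is the pairing with a symmetric matrix. -/
lemma exists_symm_pairing [DecidableEq ι] (g : Matrix ι ι ℝ →ₗ[ℝ] ℝ) :
    ∃ Q : Matrix ι ι ℝ, Qᵀ = Q ∧ ∀ M, g (M + Mᵀ) = 2 * ∑ i, ∑ j, M i j * Q i j := by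
  refine ⟨Matrix.of fun i j => (g (Matrix.single i j 1) + g (Matrix.single j i 1)) / 2,
    by ext i j; simp [add_comm], fun M => ?_⟩
  have hexpand : ∀ M, g M = ∑ i, ∑ j, M i j * g (Matrix.single i j 1) := fun M => by
    conv_lhs => rw [matrix_eq_sum_single M]
    simp only [map_sum]
    refine Finset.sum_congr rfl fun i _ => Finset.sum_congr rfl fun j _ => ?_
    rw [← smul_eq_mul, ← map_smul, smul_single, smul_eq_mul, mul_one]
  have h2 : g Mᵀ = ∑ i, ∑ j, M i j * g (Matrix.single j i 1) := by
    rw [hexpand, Finset.sum_comm]; rfl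
  rw [map_add, h2, hexpand M, Finset.mul_sum, ← Finset.sum_add_distrib]
  refine Finset.sum_congr rfl fun i _ => ?_
  rw [Finset.mul_sum, ← Finset.sum_add_distrib]
  refine Finset.sum_congr rfl fun j _ => ?_
  simp only [of_apply]
  ring

/-- Theorem of alternatives for `X ≻ 0`, `A X + B R + (A X + B R)ᵀ ≺ 0`: if there is no solution,
there is a dual certificate `Q`, which is the second component of a separating functional. -/
lemma exists_dual_of_not_exists_lmi [DecidableEq ι] (A : Matrix ι ι ℝ) (B : Matrix ι (Fin m) ℝ)
    (hno : ¬ ∃ (X : Matrix ι ι ℝ) (R : Matrix (Fin m) ι ℝ), X.PosDef ∧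
      (-((A * X + B * R) + (A * X + B * R)ᵀ)).PosDef) :
    ∃ Q : Matrix ι ι ℝ, Q.PosSemidef ∧ Q ≠ 0 ∧ Q * B = 0 ∧ ∀ y, 0 ≤ y ⬝ᵥ ((Q * A) *ᵥ y) := by
  obtain ⟨f, hf1, hfpos, hf0⟩ := exists_functional_of_not_exists_lmi A B hno
  obtain ⟨Q, hQt, hQ⟩ := exists_symm_pairing (f ∘ₗ LinearMap.inr ℝ _ _)
  simp only [LinearMap.comp_apply, LinearMap.inr_apply] at hQ
  have hQv : ∀ x y : ι → ℝ, f (0, vecMulVec x y + (vecMulVec x y)ᵀ) = 2 * (x ⬝ᵥ (Q *ᵥ y)) :=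
    fun x y => by
      rw [hQ]
      simp only [dotProduct, mulVec, vecMulVec_apply, Finset.mul_sum]
      exact Finset.sum_congr rfl fun i _ => Finset.sum_congr rfl fun j _ => by ring
  have hrel : ∀ (X : Matrix ι ι ℝ) (R : Matrix (Fin m) ι ℝ), Xᵀ = X →
      f (X, 0) = f (0, (A * X + B * R) + (A * X + B * R)ᵀ) := fun X R hX => by
    have h := hf0 _ ⟨X, R, hX, rfl⟩
    rw [show ((X, -((A * X + B * R) + (A * X + B * R)ᵀ)) : Matrix ι ι ℝ × Matrix ι ι ℝ) =
      (X, 0) - (0, (A * X + B * R) + (A * X + B * R)ᵀ) by simp, map_sub] at h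
    exact sub_eq_zero.1 h
  have hvv : ∀ x y : ι → ℝ, 0 ≤ y ⬝ᵥ (vecMulVec x x *ᵥ y) := fun x y => by
    rw [vecMulVec_mulVec, op_smul_eq_smul, dotProduct_smul, smul_eq_mul, dotProduct_comm y x]
    exact mul_self_nonneg _
  refine ⟨Q, PosSemidef.of_dotProduct_mulVec_nonneg (by simpa [IsHermitian] using hQt)
    fun x => ?_, ?_, ?_, fun y => ?_⟩
  · have h1 := hfpos 0 (vecMulVec x x + (vecMulVec x x)ᵀ) (by simp) (fun y => by
      rw [dotProduct_mulVec_add_transpose]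
      exact mul_nonneg two_pos.le (hvv x y))
    rw [hQv] at h1
    simp only [star_trivial]
    linarith
  · intro hQ0
    have h1 : ∀ M, f (0, M + Mᵀ) = 0 := fun M => by rw [hQ, hQ0]; simp
    have h2 := h1 1
    have h3 := hrel 1 0 transpose_one
    rw [h1] at h3
    have h5 : f (0, (1 : Matrix ι ι ℝ) + 1ᵀ) = f (0, 1) + f (0, 1) := by
      rw [← map_add, transpose_one, Prod.mk_add_mk, add_zero]
    have h4 : f (1, 1) = f (1, 0) + f (0, 1) := by
      rw [← map_add, Prod.mk_add_mk, add_zero, zero_add]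
    linarith
  · have h1 : ∀ (r : Fin m → ℝ) (y : ι → ℝ), (B *ᵥ r) ⬝ᵥ (Q *ᵥ y) = 0 := fun r y => by
      have h := hrel 0 (vecMulVec r y) transpose_zero
      rw [Matrix.mul_zero, zero_add, mul_vecMulVec, hQv,
        show ((0 : Matrix ι ι ℝ), (0 : Matrix ι ι ℝ)) = 0 from rfl, map_zero] at h
      linarith
    refine mulVec_injective (funext fun r => ?_)
    rw [← mulVec_mulVec, zero_mulVec]
    refine dotProduct_eq_zero _ fun y => ?_
    rw [← h1 r y, dotProduct_mulVec, ← mulVec_transpose, hQt]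
  · have h1 := hfpos (vecMulVec y y) 0 (hvv y) (by simp)
    have h2 := hrel (vecMulVec y y) 0 (transpose_vecMulVec _ _)
    rw [Matrix.mul_zero, add_zero, mul_vecMulVec, hQv, dotProduct_mulVec, ← mulVec_transpose, hQt,
      mulVec_mulVec, dotProduct_comm] at h2
    linarith

lemma vecMul_map_dotProduct_star_re (M : Matrix ι ι ℝ) (y : ι → ℂ) :
    ((y ᵥ* M.map (algebraMap ℝ ℂ)) ⬝ᵥ star y).re =
      (fun i => (y i).re) ⬝ᵥ (M *ᵥ fun i => (y i).re) +
      (fun i => (y i).im) ⬝ᵥ (M *ᵥ fun i => (y i).im) := by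
  rw [← dotProduct_mulVec]
  simp only [dotProduct, mulVec, Finset.mul_sum, ← Finset.sum_add_distrib, Complex.re_sum]
  refine Finset.sum_congr rfl fun i _ => Finset.sum_congr rfl fun j _ => ?_
  simp

lemma vecMul_map_dotProduct_star_im {M : Matrix ι ι ℝ} (hM : Mᵀ = M) (y : ι → ℂ) :
    ((y ᵥ* M.map (algebraMap ℝ ℂ)) ⬝ᵥ star y).im = 0 := by
  have h : star ((y ᵥ* M.map (algebraMap ℝ ℂ)) ⬝ᵥ star y) =
      (y ᵥ* M.map (algebraMap ℝ ℂ)) ⬝ᵥ star y := by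
    have hs : (M.map (algebraMap ℝ ℂ))ᴴ = M.map (algebraMap ℝ ℂ) := by
      ext i j
      simpa using congrFun (congrFun hM i) j
    rw [← star_dotProduct_star, star_star, star_vecMul, hs, ← dotProduct_mulVec]
  exact Complex.conj_eq_iff_im.1 h

/-- A pair `(A, B)` that passes the Hautus test on the closed right half-plane satisfies the linear
matrix inequality of a stabilizing state feedback. A dual certificate `Q` has an `A`-invariant
kernel, so that the row space of `Q` contains a left eigenvector `y Q` of `A`, which `B`
annihilates. Its eigenvalue `λ` has `Re λ · (y Q y*) = Re (y Q A y*) ≥ 0`. -/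
lemma exists_lmi_of_hautus [DecidableEq ι] (A : Matrix ι ι ℝ) (B : Matrix ι (Fin m) ℝ)
    (hAB : ∀ (l : ℂ) (v : ι → ℂ), 0 ≤ l.re → v ᵥ* A.map (algebraMap ℝ ℂ) = l • v →
      v ᵥ* B.map (algebraMap ℝ ℂ) = 0 → v = 0) :
    ∃ (X : Matrix ι ι ℝ) (R : Matrix (Fin m) ι ℝ), X.PosDef ∧
      (-((A * X + B * R) + (A * X + B * R)ᵀ)).PosDef := by
  by_contra hno
  obtain ⟨Q, hQ, hQ0, hQB, hQA⟩ := exists_dual_of_not_exists_lmi A B hno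
  have hQt : Qᵀ = Q := by simpa [IsHermitian] using hQ.isHermitian
  have hker : ∀ y, Q *ᵥ y = 0 → (Q * A) *ᵥ y = 0 := fun y hy => by
    refine dotProduct_eq_zero _ fun z => ?_
    rw [dotProduct_comm]
    by_contra hne
    -- the form at `c y + z` is affine in `c`, hence constant
    have hform : ∀ c : ℝ, 0 ≤ c * (z ⬝ᵥ ((Q * A) *ᵥ y)) + z ⬝ᵥ ((Q * A) *ᵥ z) := fun c => by
      have h := hQA (c • y + z)
      have h0 : ∀ x, y ⬝ᵥ ((Q * A) *ᵥ x) = 0 := fun x => by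
        rw [← mulVec_mulVec, dotProduct_mulVec, ← mulVec_transpose, hQt, hy, zero_dotProduct]
      simpa [mulVec_add, mulVec_smul, h0] using h
    have h := hform (-(z ⬝ᵥ ((Q * A) *ᵥ z) + 1) / (z ⬝ᵥ ((Q * A) *ᵥ y)))
    rw [div_mul_cancel₀ _ hne] at h
    linarith
  obtain ⟨N, hN⟩ : ∃ N : Matrix ι ι ℝ, Q * A = N * Q := by
    have h : ∀ j, ∃ c : ι → ℝ, ∑ i, c i • (LinearMap.proj i ∘ₗ Q.mulVecLin) =
        (LinearMap.proj j ∘ₗ (Q * A).mulVecLin : (ι → ℝ) →ₗ[ℝ] ℝ) := fun j => by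
      refine (Submodule.mem_span_range_iff_exists_fun ℝ).1
        (mem_span_of_iInf_ker_le_ker fun y hy => ?_)
      have hy' : Q *ᵥ y = 0 := funext fun i => by
        simpa using (Submodule.mem_iInf _).1 hy i
      simpa using congrFun (hker y hy') j
    choose c hc using h
    refine ⟨Matrix.of c, mulVec_injective (funext fun y => funext fun j => ?_)⟩
    have h1 := LinearMap.congr_fun (hc j) y
    have h2 : ∑ i, c j i * (Q *ᵥ y) i = ((Q * A) *ᵥ y) j := by simpa using h1
    rw [← h2, ← mulVec_mulVec y (Matrix.of c)]
    rfl
  have hmap : ∀ {κ : Type} [Fintype κ] (C : Matrix ι ι ℝ) (D : Matrix ι κ ℝ),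
      (C * D).map (algebraMap ℝ ℂ) = C.map (algebraMap ℝ ℂ) * D.map (algebraMap ℝ ℂ) :=
    fun C D => Matrix.map_mul
  let W : Submodule ℂ (ι → ℂ) := LinearMap.range (Q.map (algebraMap ℝ ℂ)).vecMulLinear
  have hW : ∀ v ∈ W, (A.map (algebraMap ℝ ℂ)).vecMulLinear v ∈ W := by
    rintro _ ⟨y, rfl⟩
    refine ⟨y ᵥ* N.map (algebraMap ℝ ℂ), ?_⟩
    simp only [vecMulLinear_apply, vecMul_vecMul, ← hmap, hN]
  have hWne : Nontrivial W := by
    rw [Submodule.nontrivial_iff_ne_bot, Ne, LinearMap.range_eq_bot]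
    intro h
    refine hQ0 (Matrix.ext fun i j => ?_)
    have h1 := congrFun (LinearMap.congr_fun h (Pi.single i 1)) j
    simpa using h1
  obtain ⟨l, hl⟩ := Module.End.exists_eigenvalue
    ((A.map (algebraMap ℝ ℂ)).vecMulLinear.restrict hW)
  obtain ⟨⟨v, y, hy⟩, hv⟩ := hl.exists_hasEigenvector
  have hvne : v ≠ 0 := fun h => hv.2 (Subtype.ext h)
  have hvA : v ᵥ* A.map (algebraMap ℝ ℂ) = l • v := congrArg Subtype.val hv.apply_eq_smul
  rw [vecMulLinear_apply] at hy
  refine hvne (hAB l v ?_ hvA ?_)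
  · have h1 : (y ᵥ* (Q * A).map (algebraMap ℝ ℂ)) ⬝ᵥ star y =
        l * ((y ᵥ* Q.map (algebraMap ℝ ℂ)) ⬝ᵥ star y) := by
      rw [hmap, ← vecMul_vecMul, hy, hvA, smul_dotProduct, smul_eq_mul]
    have h2 := congrArg Complex.re h1
    rw [Complex.mul_re, vecMul_map_dotProduct_star_im hQt, mul_zero, sub_zero,
      vecMul_map_dotProduct_star_re, vecMul_map_dotProduct_star_re] at h2
    have h3 : 0 ≤ (fun i => (y i).re) ⬝ᵥ (Q *ᵥ fun i => (y i).re) := by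
      simpa using hQ.dotProduct_mulVec_nonneg fun i => (y i).re
    have h4 : 0 ≤ (fun i => (y i).im) ⬝ᵥ (Q *ᵥ fun i => (y i).im) := by
      simpa using hQ.dotProduct_mulVec_nonneg fun i => (y i).im
    have h5 := add_nonneg (hQA fun i => (y i).re) (hQA fun i => (y i).im)
    rw [h2] at h5
    refine nonneg_of_mul_nonneg_left h5 (lt_of_le_of_ne (add_nonneg h3 h4) fun h6 => hvne ?_)
    have h7 : Q *ᵥ (fun i => (y i).re) = 0 := by
      refine (hQ.dotProduct_mulVec_zero_iff _).1 ?_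
      simp only [star_trivial]; linarith
    have h8 : Q *ᵥ (fun i => (y i).im) = 0 := by
      refine (hQ.dotProduct_mulVec_zero_iff _).1 ?_
      simp only [star_trivial]; linarith
    rw [← hQt, mulVec_transpose] at h7 h8
    rw [← hy]
    funext j
    refine Complex.ext ?_ ?_
    · simpa [vecMul, dotProduct] using congrFun h7 j
    · simpa [vecMul, dotProduct] using congrFun h8 j
  · rw [← hy, vecMul_vecMul, ← hmap, hQB]
    simp

end LMI

end OutReg

/-! ### Plant and internal model in open loop -/

namespace OutReg

section Augmented

variable {nw n m p : ℕ} (Pl : Plant nw n m p)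

/-- State matrix of the plant augmented with the internal model, in the coordinates `(x, η)`. -/
noncomputable def augA : Matrix (Fin n ⊕ ImIdx Pl.S p) (Fin n ⊕ ImIdx Pl.S p) ℝ :=
  fromBlocks Pl.A 0 (imG Pl.S p * Pl.Ce) (imΦ Pl.S p)

/-- Input matrix of the plant augmented with the internal model. -/
noncomputable def augB : Matrix (Fin n ⊕ ImIdx Pl.S p) (Fin m) ℝ := fromRows Pl.B 0

/-- Exosystem input matrix of the plant augmented with the internal model. -/
noncomputable def augP : Matrix (Fin n ⊕ ImIdx Pl.S p) (Fin nw) ℝ := fromRows Pl.P (imG Pl.S p * Pl.Qe)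

lemma aug_velocity (x : Fin n → ℝ) (η : ImIdx Pl.S p → ℝ) (u : Fin m → ℝ) (w : Fin nw → ℝ) :
    augA Pl *ᵥ Sum.elim x η + augB Pl *ᵥ u + augP Pl *ᵥ w =
      Sum.elim (Pl.A *ᵥ x + Pl.B *ᵥ u + Pl.P *ᵥ w)
        (imΦ Pl.S p *ᵥ η + imG Pl.S p *ᵥ Pl.err w x) := by
  rw [augA, augB, augP, fromBlocks_mulVec, fromRows_mulVec, fromRows_mulVec]
  ext (i | i)
  · simp
  · simp only [Sum.elim_comp_inl, Sum.elim_comp_inr, Pi.add_apply, Sum.elim_inr, Plant.err,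
      mulVec_add, mulVec_mulVec, zero_mulVec, Pi.zero_apply]
    ring

lemma closedLoopA_imRegulator (K : Matrix (Fin m) (Fin n ⊕ ImIdx Pl.S p) ℝ) :
    closedLoopA Pl (imRegulator Pl.S p K) = augA Pl + augB Pl * K := by
  rw [closedLoopA, augA, augB, fromRows_mul, Matrix.zero_mul]
  ext (i | i) (j | j)
  · simp [imRegulator, Matrix.mul_apply]
  · simp [imRegulator, Matrix.mul_apply]
  · simp [imRegulator]
  · simp [imRegulator]

/-- Along an experiment, the augmented state is a trajectory of the augmented plant. -/
lemma Experiment.isTrajectory {Pl : Plant nw n m p} {T : ℕ} (E : Experiment Pl T) :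
    IsTrajectory (fun t => Sum.elim (E.x t) (E.η t)) fun t =>
      augA Pl *ᵥ Sum.elim (E.x t) (E.η t) + augB Pl *ᵥ E.u t + augP Pl *ᵥ E.w t :=
  (E.plant.sumElim E.internalModel).congr_velocity fun _ _ => (aug_velocity Pl _ _ _ _).symm

lemma Experiment.Z0_col {Pl : Plant nw n m p} {T : ℕ} (E : Experiment Pl T) (τ : Fin T) :
    E.Z0.col τ = Sum.elim (E.x (E.t τ)) (E.η (E.t τ)) := by
  ext (i | i) <;> rfl

lemma Experiment.Z1_col {Pl : Plant nw n m p} {T : ℕ} (E : Experiment Pl T) (τ : Fin T) :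
    E.Z1.col τ = augA Pl *ᵥ E.Z0.col τ + augB Pl *ᵥ E.U0.col τ + augP Pl *ᵥ E.w (E.t τ) := by
  have hU : E.U0.col τ = E.u (E.t τ) := rfl
  rw [E.Z0_col, hU, aug_velocity]
  ext (i | i)
  · have h := congrFun (E.plant.derivWithin_eq (E.t_pos τ).le) i
    exact h
  · have h := congrFun (E.internalModel.derivWithin_eq (E.t_pos τ).le) i
    exact h

/-- Combinations of the samples that cancel the modes cancel the unmeasured exosystem state: they
yield data of the augmented plant without exosystem. -/
lemma Experiment.Z1_mul_eq {Pl : Plant nw n m p} {T : ℕ} (E : Experiment Pl T) {α : Type}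
    {Y : Matrix (Fin T) α ℝ} (hY : E.Mred * Y = 0) :
    E.Z1 * Y = augA Pl * (E.Z0 * Y) + augB Pl * (E.U0 * Y) := by
  obtain ⟨L, hL⟩ := exists_eq_mulVec_mode Pl.S E.exo
  have h : E.Z1 = augA Pl * E.Z0 + augB Pl * E.U0 + augP Pl * (L * E.Mred) := by
    refine Matrix.ext fun i τ => ?_
    have h1 := congrFun (E.Z1_col τ) i
    rw [hL _ (E.t_pos τ).le, mulVec_mulVec] at h1
    rw [← Matrix.mul_assoc]
    exact h1
  rw [h, Matrix.add_mul, Matrix.add_mul, Matrix.mul_assoc, Matrix.mul_assoc, Matrix.mul_assoc,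
    Matrix.mul_assoc, hY, Matrix.mul_zero, Matrix.mul_zero, add_zero]

end Augmented

/-! ### Feasible data yield a regulator -/

section Sufficiency

variable {nw n m p : ℕ} {Pl : Plant nw n m p}

lemma norm_sumElim {ι κ : Type} [Fintype ι] [Fintype κ] (x : ι → ℝ) (ξ : κ → ℝ) :
    ‖(Sum.elim x ξ : ι ⊕ κ → ℝ)‖ = ‖(x, ξ)‖ := by
  refine le_antisymm ((pi_norm_le_iff_of_nonneg (norm_nonneg _)).2 ?_) ?_
  · rintro (i | i)
    · exact (norm_le_pi_norm x i).trans (norm_fst_le (x, ξ))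
    · exact (norm_le_pi_norm ξ i).trans (norm_snd_le (x, ξ))
  · refine norm_prod_le_iff.2 ⟨?_, ?_⟩ <;> refine (pi_norm_le_iff_of_nonneg (norm_nonneg _)).2 ?_
    · exact fun i => norm_le_pi_norm (Sum.elim x ξ) (Sum.inl i)
    · exact fun i => norm_le_pi_norm (Sum.elim x ξ) (Sum.inr i)

lemma tendsto_prod_of_tendsto_sumElim {ι κ : Type} [Fintype ι] [Fintype κ] {x : ℝ → ι → ℝ}
    {ξ : ℝ → κ → ℝ} (h : Tendsto (fun t => (Sum.elim (x t) (ξ t) : ι ⊕ κ → ℝ)) atTop (𝓝 0)) :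
    Tendsto (fun t => (x t, ξ t)) atTop (𝓝 0) := by
  rw [tendsto_zero_iff_norm_tendsto_zero] at h ⊢
  simpa only [norm_sumElim] using h

lemma isTrajectory_of_isClosedLoop_zero {κ : Type} [Fintype κ] {R : Regulator n m p κ}
    {x : ℝ → Fin n → ℝ} {ξ : ℝ → κ → ℝ} (h : IsClosedLoop Pl R (fun _ => 0) x ξ) :
    IsTrajectory (fun t => Sum.elim (x t) (ξ t))
      (fun t => closedLoopA Pl R *ᵥ Sum.elim (x t) (ξ t)) :=
  h.isTrajectory.congr_velocity fun t _ => by rw [mulVec_zero, add_zero]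

/-- A stabilizing feedback from plant and internal model state solves the output regulation
problem. -/
lemma solvesOutputRegulation_of_lyapunov (hS : ExosystemPeriodic Pl.S)
    (K : Matrix (Fin m) (Fin n ⊕ ImIdx Pl.S p) ℝ)
    {X : Matrix (Fin n ⊕ ImIdx Pl.S p) (Fin n ⊕ ImIdx Pl.S p) ℝ} (hX : X.PosDef)
    (hA : (-((augA Pl + augB Pl * K) * X + ((augA Pl + augB Pl * K) * X)ᵀ)).PosDef) :
    SolvesOutputRegulation Pl (imRegulator Pl.S p K) := by
  rw [← closedLoopA_imRegulator] at hA
  refine ⟨fun ε hε => ?_, fun x ξ h => ?_, fun w x ξ hw h => ?_⟩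
  · obtain ⟨δ, hδ, hst⟩ := stable_of_lyapunov hX hA hε
    refine ⟨δ, hδ, fun x ξ h h0 t ht => ?_⟩
    rw [← norm_sumElim] at h0 ⊢
    exact hst _ (isTrajectory_of_isClosedLoop_zero h) h0 t ht
  · exact tendsto_prod_of_tendsto_sumElim
      (tendsto_zero_of_lyapunov hX hA (isTrajectory_of_isClosedLoop_zero h))
  · obtain ⟨Q, hQ⟩ := exists_sylvester hS (fun z hz => tendsto_zero_of_lyapunov hX hA hz)
      (closedLoopP Pl (imRegulator Pl.S p K))
    have hE : Pl.Ce * Q.toRows₁ + Pl.Qe = 0 := by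
      refine eq_zero_of_internalModel_sylvester (Q := Q.toRows₂) (p := p) ?_
      have h1 : Q.toRows₂ * Pl.S = (Q * Pl.S).toRows₂ := rfl
      rw [h1, hQ, closedLoopA, closedLoopP]
      conv_lhs => rw [← fromRows_toRows Q]
      rw [fromBlocks_mul_fromRows]
      ext i j
      simp [imRegulator, Matrix.mul_add, Matrix.mul_assoc]
      ring
    have hz : IsTrajectory (fun t => Sum.elim (x t) (ξ t) - Q *ᵥ w t)
        (fun t => closedLoopA Pl (imRegulator Pl.S p K) *ᵥ (Sum.elim (x t) (ξ t) - Q *ᵥ w t)) :=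
      (h.isTrajectory.sub (hw.mulVec Q)).congr_velocity fun t _ => by
        rw [mulVec_mulVec, hQ, add_mulVec, mulVec_sub, mulVec_mulVec]
        abel
    have hlim := tendsto_zero_of_lyapunov hX hA hz
    have hx : Tendsto (fun t i => (Sum.elim (x t) (ξ t) - Q *ᵥ w t) (Sum.inl i)) atTop (𝓝 0) :=
      tendsto_pi_nhds.2 fun i => tendsto_pi_nhds.1 hlim (Sum.inl i)
    have hcont : Continuous fun y : Fin n → ℝ => Pl.Ce *ᵥ y := by fun_prop
    have h2 := (hcont.tendsto 0).comp hx
    rw [mulVec_zero] at h2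
    refine h2.congr fun t => ?_
    have h3 : (fun i => (Sum.elim (x t) (ξ t) - Q *ᵥ w t) (Sum.inl i)) =
        x t - Q.toRows₁ *ᵥ w t := rfl
    have h4 : Pl.Qe = -(Pl.Ce * Q.toRows₁) := eq_neg_of_add_eq_zero_right hE
    rw [Function.comp_apply, h3, Plant.err, h4, mulVec_sub, mulVec_mulVec, neg_mulVec,
      sub_eq_add_neg]

end Sufficiency

/-! ### Solvability and informative data yield feasibility -/

section Necessity

variable {nw n m p : ℕ} {Pl : Plant nw n m p}

lemma tendsto_of_attractive {κ : Type} [Fintype κ] {R : Regulator n m p κ}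
    (hR : SolvesOutputRegulation Pl R) {z : ℝ → Fin n ⊕ κ → ℝ}
    (hz : IsTrajectory z fun t => closedLoopA Pl R *ᵥ z t) : Tendsto z atTop (𝓝 0) := by
  have h1 : IsTrajectory z fun t =>
      closedLoopA Pl R *ᵥ z t + closedLoopP Pl R *ᵥ (fun _ : ℝ => (0 : Fin nw → ℝ)) t :=
    hz.congr_velocity fun t _ => by rw [mulVec_zero, add_zero]
  have h2 := hR.attractive _ _ h1.isClosedLoop
  rw [tendsto_zero_iff_norm_tendsto_zero] at h2 ⊢
  refine h2.congr fun t => ?_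
  rw [← norm_sumElim]
  congr 1
  ext (i | i) <;> rfl

/-- Solvability of the output regulation problem implies solvability of the regulator equations.
The solution comes from the Sylvester equation of the closed loop: along its graph the error is
periodic and tends to zero. -/
lemma exists_regulator_equations (hS : ExosystemPeriodic Pl.S) {κ : Type} [Fintype κ]
    {R : Regulator n m p κ} (hR : SolvesOutputRegulation Pl R) :
    ∃ (Q : Matrix (Fin n) (Fin nw) ℝ) (Γ : Matrix (Fin m) (Fin nw) ℝ),
      Q * Pl.S = Pl.A * Q + Pl.B * Γ + Pl.P ∧ Pl.Ce * Q + Pl.Qe = 0 := by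
  obtain ⟨Q, hQ⟩ := exists_sylvester hS (fun z hz => tendsto_of_attractive hR hz)
    (closedLoopP Pl R)
  refine ⟨Q.toRows₁, R.He * (Pl.Ce * Q.toRows₁ + Pl.Qe) + R.Hx * Q.toRows₁ + R.H * Q.toRows₂,
    ?_, ?_⟩
  · have h1 : Q.toRows₁ * Pl.S = (Q * Pl.S).toRows₁ := rfl
    rw [h1, hQ, closedLoopA, closedLoopP]
    conv_lhs => rw [← fromRows_toRows Q]
    rw [fromBlocks_mul_fromRows]
    ext i j
    simp [Matrix.mul_add, Matrix.add_mul, Matrix.mul_assoc]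
    ring
  · refine mulVec_injective (funext fun w₀ => ?_)
    obtain ⟨w, hw0, hw⟩ := exists_hasDerivAt_mulVec Pl.S w₀
    obtain ⟨-, D, hD, hper⟩ := hS w hw
    have hz : IsTrajectory (fun t => Q *ᵥ w t)
        (fun t => closedLoopA Pl R *ᵥ (Q *ᵥ w t) + closedLoopP Pl R *ᵥ w t) :=
      IsTrajectory.of_hasDerivAt fun t => by
        rw [mulVec_mulVec, ← add_mulVec, ← hQ, ← mulVec_mulVec]
        exact hasDerivAt_mulVec (hw t) Q
    have herr := hR.regulates w _ _ (IsTrajectory.of_hasDerivAt hw) hz.isClosedLoop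
    have hEw : (fun t => Pl.err (w t) fun i => (Q *ᵥ w t) (Sum.inl i)) =
        fun t => (Pl.Ce * Q.toRows₁ + Pl.Qe) *ᵥ w t := by
      funext t
      rw [Plant.err, add_mulVec, ← mulVec_mulVec]
      rfl
    rw [hEw] at herr
    have h := eq_zero_of_periodic_of_tendsto hD
      (hper.comp fun y => (Pl.Ce * Q.toRows₁ + Pl.Qe) *ᵥ y) herr 0
    rw [zero_mulVec, ← hw0]
    exact h

/-- A plant for which the output regulation problem is solvable has no uncontrollable unstable
modes. -/
lemma eq_zero_of_vecMul_of_solvesOutputRegulation {κ : Type} [Fintype κ] {R : Regulator n m p κ}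
    (hR : SolvesOutputRegulation Pl R) {l : ℂ} (hl : 0 ≤ l.re) {v : Fin n → ℂ}
    (hA : v ᵥ* Pl.A.map (algebraMap ℝ ℂ) = l • v) (hB : v ᵥ* Pl.B.map (algebraMap ℝ ℂ) = 0) :
    v = 0 := by
  have key : ∀ x₀ : Fin n → ℝ, v ⬝ᵥ (fun i => (x₀ i : ℂ)) = 0 := fun x₀ => by
    obtain ⟨z, hz0, hz⟩ := exists_hasDerivAt_mulVec (closedLoopA Pl R) (Sum.elim x₀ 0)
    have hz' := IsTrajectory.of_hasDerivAt hz
    have hlim := tendsto_of_attractive hR hz'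
    have hcl : IsClosedLoop Pl R (fun _ => 0) _ _ := IsTrajectory.isClosedLoop (z := z)
      (hz'.congr_velocity fun t _ => by rw [mulVec_zero, add_zero])
    have hexp := fun t ht => hcl.plant.dotProduct_eq_exp v l (fun t _ => by
      rw [mulVec_zero, add_zero, ← smul_eq_mul, ← smul_dotProduct, ← hA, ← dotProduct_mulVec]
      have hB' : ∀ u : Fin m → ℝ, v ⬝ᵥ (fun i => ((Pl.B *ᵥ u) i : ℂ)) = 0 := fun u => by
        rw [show (fun i => ((Pl.B *ᵥ u) i : ℂ)) =
          Pl.B.map (algebraMap ℝ ℂ) *ᵥ fun i => (u i : ℂ) by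
            funext i; simp [mulVec, dotProduct], dotProduct_mulVec, hB, zero_dotProduct]
      rw [show (Pl.A.map (algebraMap ℝ ℂ) *ᵥ fun i => ((z t (Sum.inl i) : ℝ) : ℂ)) =
          fun i => ((Pl.A *ᵥ fun i => z t (Sum.inl i)) i : ℂ) by
            funext i; simp [mulVec, dotProduct]]
      simp only [Pi.add_apply, Complex.ofReal_add]
      rw [← Pi.add_def, dotProduct_add, hB', add_zero]) (t := t) ht
    have h0 : (fun i => ((z 0 (Sum.inl i) : ℝ) : ℂ)) = fun i => (x₀ i : ℂ) := by rw [hz0]; rfl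
    rw [h0] at hexp
    have hlim' : Tendsto (fun t => v ⬝ᵥ fun i => ((z t (Sum.inl i) : ℝ) : ℂ)) atTop (𝓝 0) := by
      simp only [dotProduct]
      rw [show (0 : ℂ) = ∑ i, v i * ((0 : ℝ) : ℂ) by simp]
      exact tendsto_finsetSum _ fun i _ => Tendsto.const_mul _
        ((Complex.continuous_ofReal.tendsto 0).comp (tendsto_pi_nhds.1 hlim (Sum.inl i)))
    rw [← norm_le_zero_iff]
    refine ge_of_tendsto (tendsto_zero_iff_norm_tendsto_zero.1 hlim') ?_
    filter_upwards [eventually_ge_atTop 0] with t ht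
    rw [hexp t ht, norm_mul, Complex.norm_exp]
    refine le_mul_of_one_le_right (norm_nonneg _) (Real.one_le_exp ?_)
    simpa using mul_nonneg hl ht
  funext i
  have h := key (Pi.single i 1)
  rw [show (fun j => ((Pi.single i (1 : ℝ) : Fin n → ℝ) j : ℂ)) = Pi.single i 1 by
    funext j; by_cases hj : j = i
    · subst hj; simp
    · simp [hj]] at h
  simpa using h

/-- Rows that are linearly independent over the reals are so over the complex numbers. -/
lemma eq_zero_of_vecMul_map_eq_zero {α β : Type} [Fintype α] {D : Matrix α β ℝ}
    (hD : LinearIndependent ℝ D.row) {c : α → ℂ} (hc : c ᵥ* D.map (algebraMap ℝ ℂ) = 0) :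
    c = 0 := by
  have hinj := vecMul_injective_iff.2 hD
  have hre : (fun i => (c i).re) = 0 := hinj (by
    funext j
    simpa [vecMul, dotProduct] using congrArg Complex.re (congrFun hc j))
  have him : (fun i => (c i).im) = 0 := hinj (by
    funext j
    simpa [vecMul, dotProduct] using congrArg Complex.im (congrFun hc j))
  exact funext fun i => Complex.ext (congrFun hre i) (congrFun him i)

lemma exists_mul_eq_of_linearIndependent_row {α β γ : Type} [Fintype α] [Fintype β]
    {D : Matrix α β ℝ} (hD : LinearIndependent ℝ D.row) (N : Matrix α γ ℝ) : ∃ Y : Matrix β γ ℝ, D * Y = N := by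
  classical
  obtain ⟨g, hg⟩ := D.vecMulLinear.exists_leftInverse_of_injective
    (LinearMap.ker_eq_bot.2 (vecMul_injective_iff.2 hD))
  have h1 : D * (LinearMap.toMatrix' g)ᵀ = 1 := vecMul_injective (funext fun r => by
    change r ᵥ* (D * (LinearMap.toMatrix' g)ᵀ) = r ᵥ* 1
    rw [← vecMul_vecMul, vecMul_transpose, LinearMap.toMatrix'_mulVec, vecMul_one]
    exact LinearMap.congr_fun hg r)
  exact ⟨(LinearMap.toMatrix' g)ᵀ * N, by rw [← Matrix.mul_assoc, h1, Matrix.one_mul]⟩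

/-- Hautus test for the augmented plant. A left eigenvector `v` at an eigenvalue of `S` that the
input does not reach makes `v ⬝ (z - Ψ w)` a multiple of `e^{λt}`, where `Ψ` solves the regulator
equations; then the samples of `v ⬝ z` are combinations of the sampled modes. -/
lemma hautus_aug (hS : ExosystemPeriodic Pl.S) (hsolv : OutputRegulationSolvable Pl) {T : ℕ}
    (E : Experiment Pl T) (hD : LinearIndependent ℝ E.dataMatrix.row) (l : ℂ)
    (v : Fin n ⊕ ImIdx Pl.S p → ℂ) (hl : 0 ≤ l.re)
    (hA : v ᵥ* (augA Pl).map (algebraMap ℝ ℂ) = l • v)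
    (hB : v ᵥ* (augB Pl).map (algebraMap ℝ ℂ) = 0) : v = 0 := by
  obtain ⟨ν, R, hR⟩ := hsolv
  by_cases hroot : Polynomial.aeval l (minpoly ℝ Pl.S) = 0
  · obtain ⟨Q, Γ, hQ, hE⟩ := exists_regulator_equations hS hR
    -- in steady state the internal model is at rest
    let Ψ : Matrix (Fin n ⊕ ImIdx Pl.S p) (Fin nw) ℝ := fromRows Q 0
    have hΨ : Ψ * Pl.S = augA Pl * Ψ + augB Pl * Γ + augP Pl := by
      simp only [Ψ, augA, augB, augP, fromRows_mul, fromBlocks_mul_fromRows]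
      have h1 : imG Pl.S p * Pl.Ce * Q + imG Pl.S p * Pl.Qe = 0 := by
        rw [Matrix.mul_assoc, ← Matrix.mul_add, hE, Matrix.mul_zero]
      refine Matrix.ext fun i j => ?_
      rcases i with i | i
      · simp [hQ]
      · simpa using (congrFun (congrFun h1 i) j).symm
    have hz := E.isTrajectory.sub (E.exo.mulVec Ψ)
    have hcast : ∀ {α β : Type} [Fintype β] (M : Matrix α β ℝ) (y : β → ℝ),
        (fun i => ((M *ᵥ y) i : ℂ)) = M.map (algebraMap ℝ ℂ) *ᵥ fun i => (y i : ℂ) :=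
      fun M y => by funext i; simp [mulVec, dotProduct]
    have hexp := fun t ht => hz.dotProduct_eq_exp v l (fun t _ => by
      have hv : augA Pl *ᵥ Sum.elim (E.x t) (E.η t) + augB Pl *ᵥ E.u t + augP Pl *ᵥ E.w t -
          Ψ *ᵥ (Pl.S *ᵥ E.w t) = augA Pl *ᵥ (Sum.elim (E.x t) (E.η t) - Ψ *ᵥ E.w t) +
            augB Pl *ᵥ (E.u t - Γ *ᵥ E.w t) := by
        rw [mulVec_mulVec, hΨ]
        simp only [add_mulVec, mulVec_sub, mulVec_mulVec]
        abel
      rw [hv]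
      simp only [Pi.add_apply, Complex.ofReal_add]
      rw [← Pi.add_def, dotProduct_add, hcast, hcast, dotProduct_mulVec, dotProduct_mulVec, hA, hB,
        zero_dotProduct, add_zero, smul_dotProduct, smul_eq_mul]) (t := t) ht
    obtain ⟨L, hL⟩ := exists_eq_mulVec_mode Pl.S E.exo
    obtain ⟨a, ha⟩ : ∃ a : ModeIdx Pl.S → ℂ, ∑ k, a k • (fun t : ℝ => (mode Pl.S k t : ℂ)) =
        fun t : ℝ => (t : ℂ) ^ 0 / (0 ! : ℂ) * Complex.exp (l * t) :=
      (Submodule.mem_span_range_iff_exists_fun ℂ).1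
        (pow_mul_cexp_mem_modeSpan Pl.S ((blockOrder_pos_iff Pl.S).2 hroot))
    generalize hc : (v ⬝ᵥ fun i => (((Sum.elim (E.x 0) (E.η 0) - Ψ *ᵥ E.w 0) i : ℝ) : ℂ)) = c
      at hexp
    have hrow : (Sum.elim 0 (Sum.elim v (-(c • a + v ᵥ* (Ψ * L).map (algebraMap ℝ ℂ))))) ᵥ*
        E.dataMatrix.map (algebraMap ℝ ℂ) = 0 := by
      funext τ
      have h1 := hexp (E.t τ) (E.t_pos τ).le
      have h2 := congrFun ha (E.t τ)
      simp only [Finset.sum_apply, Pi.smul_apply, smul_eq_mul, pow_zero, Nat.factorial_zero,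
        Nat.cast_one, div_one, one_mul] at h2
      have h3 : (fun i => ((Ψ *ᵥ E.w (E.t τ)) i : ℂ)) = (Ψ * L).map (algebraMap ℝ ℂ) *ᵥ
          fun k => (mode Pl.S k (E.t τ) : ℂ) := by
        rw [hL _ (E.t_pos τ).le, mulVec_mulVec, hcast]
      simp only [Pi.sub_apply, Complex.ofReal_sub] at h1
      rw [← Pi.sub_def, dotProduct_sub, h3, dotProduct_mulVec, ← h2] at h1
      have h4 : (E.dataMatrix.map (algebraMap ℝ ℂ)).col τ =
          Sum.elim (fun i => (E.u (E.t τ) i : ℂ))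
            (Sum.elim (fun i => ((Sum.elim (E.x (E.t τ)) (E.η (E.t τ)) i : ℝ) : ℂ))
              (fun k => (mode Pl.S k (E.t τ) : ℂ))) := by
        ext (i | (i | i) | i) <;> rfl
      change _ ⬝ᵥ (E.dataMatrix.map (algebraMap ℝ ℂ)).col τ = 0
      rw [h4, sumElim_dotProduct_sumElim, sumElim_dotProduct_sumElim, zero_dotProduct, zero_add,
        neg_dotProduct, add_dotProduct, smul_dotProduct, smul_eq_mul]
      have h5 : a ⬝ᵥ (fun k => (mode Pl.S k (E.t τ) : ℂ)) = ∑ k, a k * (mode Pl.S k (E.t τ) : ℂ) :=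
        rfl
      rw [h5]
      linear_combination h1
    have h0 := eq_zero_of_vecMul_map_eq_zero hD hrow
    funext i
    exact congrFun h0 (Sum.inr (Sum.inl i))
  · have hsplit : v = Sum.elim (v ∘ Sum.inl) (v ∘ Sum.inr) := (Sum.elim_comp_inl_inr v).symm
    rw [hsplit, augA, fromBlocks_map, vecMul_fromBlocks] at hA
    rw [hsplit, augB, fromRows_map, vecMul_fromRows] at hB
    have h2 : v ∘ Sum.inr = 0 := by
      refine eq_zero_of_vecMul_map_imΦ hroot (funext fun i => ?_)
      simpa [Matrix.map_zero] using congrFun hA (Sum.inr i)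
    have h1 : v ∘ Sum.inl = 0 := by
      refine eq_zero_of_vecMul_of_solvesOutputRegulation hR hl (funext fun i => ?_)
        (funext fun i => ?_)
      · simpa [h2] using congrFun hA (Sum.inl i)
      · simpa [h2] using congrFun hB i
    rw [hsplit, h1, h2]
    ext (i | i) <;> rfl

end Necessity

end OutReg

theorem mainTheorem3 {nw n m p : ℕ} (Pl : OutReg.Plant nw n m p)
    (hS : OutReg.ExosystemPeriodic Pl.S) {T : ℕ} (E : OutReg.Experiment Pl T) :
    (∀ (X : Matrix (Fin n ⊕ OutReg.ImIdx Pl.S p) (Fin n ⊕ OutReg.ImIdx Pl.S p) ℝ)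
        (Y : Matrix (Fin T) (Fin n ⊕ OutReg.ImIdx Pl.S p) ℝ),
      E.SDPFeasible X Y →
        OutReg.SolvesOutputRegulation Pl (OutReg.imRegulator Pl.S p (E.U0 * Y * X⁻¹))) ∧
    (LinearIndependent ℝ E.dataMatrix.row → OutReg.OutputRegulationSolvable Pl →
      ∃ (X : Matrix (Fin n ⊕ OutReg.ImIdx Pl.S p) (Fin n ⊕ OutReg.ImIdx Pl.S p) ℝ)
        (Y : Matrix (Fin T) (Fin n ⊕ OutReg.ImIdx Pl.S p) ℝ), E.SDPFeasible X Y) := by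
  refine ⟨fun X Y ⟨hX, hXY, hneg⟩ => ?_, fun hD hsolv => ?_⟩
  · rw [fromRows_mul, fromRows_inj.eq_iff] at hXY
    obtain ⟨hXY, hMY⟩ := hXY
    refine OutReg.solvesOutputRegulation_of_lyapunov hS _ hX ?_
    have hXu : IsUnit X.det := (isUnit_iff_isUnit_det X).1 hX.isUnit
    have h1 : (OutReg.augA Pl + OutReg.augB Pl * (E.U0 * Y * X⁻¹)) * X = E.Z1 * Y := by
      rw [E.Z1_mul_eq hMY.symm, ← hXY, Matrix.add_mul, Matrix.mul_assoc (OutReg.augB Pl),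
        Matrix.mul_assoc (E.U0 * Y), nonsing_inv_mul _ hXu, Matrix.mul_one]
    rw [h1, transpose_mul]
    exact hneg
  · obtain ⟨X, R, hX, hR⟩ := OutReg.exists_lmi_of_hautus (OutReg.augA Pl) (OutReg.augB Pl)
      (OutReg.hautus_aug hS hsolv E hD)
    obtain ⟨Y, hY⟩ := OutReg.exists_mul_eq_of_linearIndependent_row hD
      (fromRows R (fromRows X (0 : Matrix (OutReg.ModeIdx Pl.S) _ ℝ)))
    rw [OutReg.Experiment.dataMatrix, fromRows_mul, fromRows_inj.eq_iff] at hY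
    obtain ⟨hU, hZM⟩ := hY
    have hZM' := hZM
    rw [fromRows_mul, fromRows_inj.eq_iff] at hZM'
    obtain ⟨hZ, hM⟩ := hZM'
    refine ⟨X, Y, hX, hZM.symm, ?_⟩
    rw [← transpose_mul, E.Z1_mul_eq hM, hZ, hU]
    exact hR
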